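/- Let $n\ge 3$. A \emph{$C^0$-asymptotically flat end} of dimension $n$ is an exterior region $\mathcal E=\{x\in\mathbb R^n: |x|>r_0\}$, $r_0>0$, with a continuous Riemannian metric $g$ such that $|g_{ij}-\delta_{ij}|\le C|x|^{-\tau}$ on $\mathcal E$ for some constants $C,\tau>0$. A \emph{one-ended $C^0$-asymptotically flat manifold with end $(\mathcal E,g)$} is a smooth $n$-manifold $M$ (possibly with boundary) with a continuous Riemannian metric, also denoted $g$, for which there are a compact set $K\subset M$, a number $R\ge r_0$ and a diffeomorphism $\Phi:M\smallsetminus K\to\{|x|>R\}$ carrying the metric of $M$ to $g|_{\{|x|>R\}}$, such that the sets $K\cup\{\,|\Phi|\le\rho\}$ are compact for all $\rho$ (so $M$ is complete). For a bounded (that is, relatively compact) open set $\Omega\subset M$ of finite perimeter, let $|\Omega|$ and $|\partial^*\Omega|$ be its volume and perimeter with respect to $g$, where subsets of $\partial M$ do not count towards the perimeter, let $\omega_{n-1}$ be the area of the unit sphere in $\mathbb R^n$, and define the quasilocal isoperimetric mass \[ m^{\mathrm{QL}}_{\mathrm{iso}}(\Omega)=\frac{2}{\omega_{n-1}^{\frac{n-3}{n-1}}\,|\partial^*\Omega|^{\frac{2}{n-1}}}\left(|\Omega|-\frac{|\partial^*\Omega|^{\frac{n}{n-1}}}{n\,\omega_{n-1}^{\frac1{n-1}}}\right),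 \] which for $n=3$ is $\frac{2}{|\partial^*\Omega|}\bigl(|\Omega|-\frac{1}{6\sqrt\pi}|\partial^*\Omega|^{3/2}\bigr)$. (If $|\partial^*\Omega|=0$, set $m^{\mathrm{QL}}_{\mathrm{iso}}(\Omega)=0$; this does not happen for large members of an exhaustion of $M$.) The isoperimetric mass is \[ m_{\mathrm{iso}}(M,g)=\sup_{\{\Omega_i\}}\ \limsup_{i\to\infty}\, m^{\mathrm{QL}}_{\mathrm{iso}}(\Omega_i)\in[-\infty,\infty], \] the supremum being over all increasing sequences of bounded open sets $\Omega_i$ of finite perimeter with $\bigcup_i\Omega_i=M$. The isoperimetric mass $m_{\mathrm{iso}}(\mathcal E,g)$ of the end is $m_{\mathrm{iso}}(M,g)$ for any one-ended $C^0$-asymptotically flat manifold $(M,g)$ with end $(\mathcal E,g)$. \textbf{Theorem.} Let $(\mathcal E,g)$ be a $C^0$-asymptotically flat end of dimension $n\ge3$. Then $m_{\mathrm{iso}}(\mathcal E,g)\ge 0$. That is, there is a one-ended $C^0$-asymptotically flat manifold with end $(\mathcal E,g)$ (one may take $M=\mathbb R^n$), and $m_{\mathrm{iso}}(M,g)\ge0$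 for every such manifold $(M,g)$. -/

import Mathlib

open Bundle Manifold MeasureTheory Filter Set
open scoped Topology ENNReal ContDiff Manifold

noncomputable section

namespace IsoMass

/-- Euclidean `n`-space with its Euclidean norm. -/
abbrev Euc (n : ℕ) := EuclideanSpace ℝ (Fin n)

/-- The `i`-th standard coordinate vector. -/
abbrev stdVec {n : ℕ} (i : Fin n) : Euc n := EuclideanSpace.single i (1 : ℝ)

/-- A `C⁰`-asymptotically flat end of dimension `n`: the exterior region `{x : r₀ < |x|}` of `ℝⁿ`
with a continuous Riemannian metric `g` such that `|g_ij - δ_ij| ≤ C |x|^(-τ)` for some constants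
`C, τ > 0`. The values of `coeff` outside of the exterior region are irrelevant. -/
structure AFEnd (n : ℕ) where
  r₀ : ℝ
  r₀_pos : 0 < r₀
  coeff : Euc n → Matrix (Fin n) (Fin n) ℝ
  continuousOn_coeff : ContinuousOn coeff {x | r₀ < ‖x‖}
  posDef_coeff : ∀ x, r₀ < ‖x‖ → (coeff x).PosDef
  decay : ∃ C τ : ℝ, 0 < C ∧ 0 < τ ∧ ∀ x, r₀ < ‖x‖ → ∀ i j,
    |coeff x i j - (1 : Matrix (Fin n) (Fin n) ℝ) i j| ≤ C * ‖x‖ ^ (-τ)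

section Manifold

variable {n : ℕ} {H : Type*} [TopologicalSpace H] (I : ModelWithCorners ℝ (Euc n) H)
  {M : Type*} [TopologicalSpace M] [ChartedSpace H M] [IsManifold I ∞ M]

variable (M) in
/-- A `C⁰` Riemannian metric on the smooth `n`-manifold `M`. (For manifolds without boundary take
`I = 𝓡 n`, for manifolds with boundary take `I = 𝓡∂ n`.) -/
abbrev C0Metric := ContinuousRiemannianMetric (Euc n) (fun p : M => TangentSpace I p)

variable {I}
variable (g : C0Metric I M)

/-- The components `g_ij` of the metric at the point with coordinates `x` in the preferred chart
at `p`. -/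
def gramMatrix (p : M) (x : Euc n) : Matrix (Fin n) (Fin n) ℝ :=
  Matrix.of fun i j =>
    g.inner ((extChartAt I p).symm x)
      (mfderivWithin 𝓘(ℝ, Euc n) I (extChartAt I p).symm (range I) x (stdVec i))
      (mfderivWithin 𝓘(ℝ, Euc n) I (extChartAt I p).symm (range I) x (stdVec j))

section Measure

variable [MeasurableSpace M] [BorelSpace M]

/-- The Riemannian volume in the domain `U` of the preferred chart `φ` at `p`, as a Borel measure
on `M`: `A ↦ ∫_{φ(A ∩ U)} √(det g_ij) dx`. -/
def chartVolume (p : M) : Measure M :=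
  ((volume.restrict (extChartAt I p).target).withDensity
    fun x => ENNReal.ofReal (Real.sqrt (gramMatrix g p x).det)).map (extChartAt I p).symm

/-- The Riemannian volume measure of `g`: the least Borel measure that dominates the coordinate
volumes of all charts. As the coordinate volumes of two charts agree on the overlap of their
domains, this is the unique Borel measure that is given by `√(det g_ij) dx` in each chart. -/
def riemVolume : Measure M := ⨆ p : M, chartVolume g p

/-- The pointwise norm `|∇f|_g = |df|_g` of the gradient of `f` at `p`, as the dual norm of the
differential. -/
def gradNorm (f : M → ℝ) (p : M) : ℝ≥0∞ :=
  ⨆ (v : TangentSpace I p) (_ : g.inner p v v ≤ 1),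
    ENNReal.ofReal |(mfderiv I 𝓘(ℝ, ℝ) f p v : ℝ)|

/-- `f k → 1_Ω` in `L¹_loc(M, g)`. -/
def TendstoIndicatorL1Loc (f : ℕ → M → ℝ) (Ω : Set M) : Prop :=
  ∀ C : Set M, IsCompact C →
    Tendsto (fun k => ∫⁻ p in C, ENNReal.ofReal |f k p - Ω.indicator (fun _ => (1 : ℝ)) p|
      ∂(riemVolume g)) atTop (𝓝 0)

/-- The perimeter `|∂*Ω|` of `Ω` with respect to `g`, i.e. the total variation of `1_Ω`: the
infimum of `liminf_k ∫_M |∇f_k|_g dV_g` over the sequences of `C¹` functions `f_k` that converge to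
`1_Ω` in `L¹_loc`. This is the relaxation form of the total variation, which makes sense for
continuous metrics. Subsets of the boundary of `M` do not contribute. -/
def perimeter (Ω : Set M) : ℝ≥0∞ :=
  ⨅ (f : ℕ → M → ℝ) (_ : ∀ k, ContMDiff I 𝓘(ℝ, ℝ) 1 (f k))
    (_ : TendstoIndicatorL1Loc g f Ω),
    liminf (fun k => ∫⁻ p, gradNorm g (f k) p ∂(riemVolume g)) atTop

variable (n) in
/-- The area `ω_{n-1}` of the unit sphere in `ℝⁿ`, that is `n` times the volume of the unit
ball. -/
def sphereArea : ℝ := n * (volume (Metric.ball (0 : Euc n) 1)).toReal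

/-- The quasilocal isoperimetric mass in dimension `n`. With `V = |Ω|`, `P = |∂*Ω|` and
`ω = ω_{n-1}` it is
`2 / (ω^((n-3)/(n-1)) P^(2/(n-1))) * (V - P^(n/(n-1)) / (n ω^(1/(n-1))))`;
for `n = 3` this is `(2 / P) * (V - P^(3/2) / (6 √π))`. -/
def quasilocalMass (Ω : Set M) : ℝ :=
  2 / (sphereArea n ^ (((n : ℝ) - 3) / ((n : ℝ) - 1)) *
      (perimeter g Ω).toReal ^ (2 / ((n : ℝ) - 1))) *
    ((riemVolume g Ω).toReal -
      (perimeter g Ω).toReal ^ ((n : ℝ) / ((n : ℝ) - 1)) /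
        (n * sphereArea n ^ (1 / ((n : ℝ) - 1))))

/-- `Ω 0 ⊆ Ω 1 ⊆ …` is an exhaustion of `M` by bounded open sets with finite perimeter. `M` being
complete, bounded means relatively compact. -/
structure IsExhaustion (Ω : ℕ → Set M) : Prop where
  isOpen : ∀ i, IsOpen (Ω i)
  bounded : ∀ i, IsCompact (closure (Ω i))
  perimeter_lt_top : ∀ i, perimeter g (Ω i) < ⊤
  monotone : Monotone Ω
  iUnion_eq : ⋃ i, Ω i = univ

/-- The isoperimetric mass `m_iso(M, g)`, an extended real number: the supremum over all exhaustions
of the limsup of the quasilocal isoperimetric masses. -/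
def isoMass : EReal :=
  ⨆ (Ω : ℕ → Set M) (_ : IsExhaustion g Ω),
    limsup (fun i => ((quasilocalMass g (Ω i) : ℝ) : EReal)) atTop

end Measure

/-- `(M, g)` is a one-ended `C⁰`-asymptotically flat manifold whose end is (a neighborhood of
infinity in) `E`: the complement of a compact set `core` is diffeomorphic, by `chart`, to
`{x : R < |x|}` with `R ≥ r₀`, and in this chart the metric is that of `E`. The
coordinate spheres enclose compact regions of `M`, that is, `|x| → ∞` is the only end of `M` (and
`M` is complete). -/
structure Filling (E : AFEnd n) (g : C0Metric I M) where
  R : ℝ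
  r₀_le : E.r₀ ≤ R
  core : Set M
  isCompact_core : IsCompact core
  chart : OpenPartialHomeomorph M (Euc n)
  source_eq : chart.source = coreᶜ
  target_eq : chart.target = {x | R < ‖x‖}
  contMDiffOn_chart : ContMDiffOn I 𝓘(ℝ, Euc n) ∞ chart chart.source
  contMDiffOn_symm : ContMDiffOn 𝓘(ℝ, Euc n) I ∞ chart.symm chart.target
  metric_eq : ∀ x, R < ‖x‖ → ∀ i j,
    g.inner (chart.symm x)
      (mfderiv 𝓘(ℝ, Euc n) I chart.symm x (stdVec i))
      (mfderiv 𝓘(ℝ, Euc n) I chart.symm x (stdVec j)) = E.coeff x i j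
  isCompact_enclosed : ∀ ρ : ℝ, IsCompact (core ∪ {p | p ∉ core ∧ ‖chart p‖ ≤ ρ})

end Manifold

end IsoMass

end

/-! The mass is bounded below by explicit competitors. Fill a large coordinate sphere of radius `s`
and add a coordinate ball of radius `ρ` centred far away at `c`, disjoint from the rest. The inner
part costs perimeter at most `p = 4 ω s^(n-1)`, and its volume can be discarded. The ball is almost
Euclidean because the metric tends to the flat one at infinity; no rate of decay is needed.

For an exact Euclidean ball with extra perimeter `p`, let `r` be the radius of the sphere of area `p
+ ω ρ^(n-1)` and put `c = p / ω`. Then `r^(n-1) = ρ^(n-1) + c` forces `r^n - ρ^n ≤ 2 c r`, so the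
quasilocal mass is at least a dimensional multiple of `-c / ρ`. Hence the choices are made in the
order `s`, `ρ`, `δ`, centre: `ρ` so large that the mass exceeds `-ε`, then by continuity a tolerance
`δ` for the metric (`exists_radius_lt_massFun`), then a centre so distant that the metric is
`δ`-near Euclidean on the ball (`exists_region`). Taking the next `s` large enough to swallow the
previous ball gives an exhaustion along which the mass exceeds `-1/(i+1)` (`isoMass_nonneg`).

The geometric work is threefold. `IsCoord.riemVolume_apply` computes the volume, defined as a
supremum over preferred charts, in the chart of the end. `perimeter_region_le` bounds the relaxed
perimeter with radial cutoffs. `exists_encloses` shows that the core does not touch infinity, so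
that these cutoffs extend smoothly by `1` over the core. -/

noncomputable section

namespace IsoMass

/-! ### Radial cutoff functions and the Euclidean integrals of their gradients. -/

/-- A smooth profile that is `1` on `|r| ≤ a`, is `0` on `|r| ≥ b` and decreases in between. -/
def profile (a b r : ℝ) : ℝ := Real.smoothTransition ((b ^ 2 - r ^ 2) / (b ^ 2 - a ^ 2))

/-- The smooth cutoff function between the concentric balls of radii `a` and `b` about `c`. -/
def ramp {n : ℕ} (c : Euc n) (a b : ℝ) (x : Euc n) : ℝ := profile a b ‖x - c‖

section Profile

variable {a b : ℝ}

theorem sq_sub_sq_pos (ha : 0 ≤ a) (hab : a < b) : 0 < b ^ 2 - a ^ 2 := by nlinarith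

theorem profile_nonneg (a b r : ℝ) : 0 ≤ profile a b r := Real.smoothTransition.nonneg _

theorem profile_le_one (a b r : ℝ) : profile a b r ≤ 1 := Real.smoothTransition.le_one _

theorem profile_eq_one (ha : 0 ≤ a) (hab : a < b) {r : ℝ} (hr : 0 ≤ r) (hra : r ≤ a) :
    profile a b r = 1 := by
  apply Real.smoothTransition.one_of_one_le
  rw [one_le_div (sq_sub_sq_pos ha hab)]
  nlinarith

theorem profile_eq_zero (ha : 0 ≤ a) (hab : a < b) {r : ℝ} (hr : b ≤ r) :
    profile a b r = 0 := by
  apply Real.smoothTransition.zero_of_nonpos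
  apply div_nonpos_of_nonpos_of_nonneg _ (sq_sub_sq_pos ha hab).le
  nlinarith

theorem contDiff_profile (a b : ℝ) : ContDiff ℝ 1 (profile a b) :=
  Real.smoothTransition.contDiff.comp (by fun_prop)

theorem deriv_profile (a b r : ℝ) :
    deriv (profile a b) r = deriv Real.smoothTransition ((b ^ 2 - r ^ 2) / (b ^ 2 - a ^ 2)) *
      (-(2 * r) / (b ^ 2 - a ^ 2)) := by
  have h1 : HasDerivAt Real.smoothTransition
      (deriv Real.smoothTransition ((b ^ 2 - r ^ 2) / (b ^ 2 - a ^ 2)))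
      ((b ^ 2 - r ^ 2) / (b ^ 2 - a ^ 2)) :=
    ((Real.smoothTransition.contDiff (n := 1)).differentiable (by norm_num) _).hasDerivAt
  have h2 : HasDerivAt (fun r : ℝ => (b ^ 2 - r ^ 2) / (b ^ 2 - a ^ 2))
      (-(2 * r) / (b ^ 2 - a ^ 2)) r := by
    have := ((hasDerivAt_pow 2 r).const_sub (b ^ 2)).div_const (b ^ 2 - a ^ 2)
    simpa using this
  exact (h1.comp r h2).deriv

theorem deriv_profile_nonpos (ha : 0 ≤ a) (hab : a < b) {r : ℝ} (hr : 0 ≤ r) :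
    deriv (profile a b) r ≤ 0 := by
  rw [deriv_profile]
  have := sq_sub_sq_pos ha hab
  apply mul_nonpos_of_nonneg_of_nonpos
  · exact Real.smoothTransition.monotone.deriv_nonneg
  · apply div_nonpos_of_nonpos_of_nonneg <;> linarith

theorem deriv_profile_eq_zero (ha : 0 ≤ a) (hab : a < b) {r : ℝ} (hr : b < r) :
    deriv (profile a b) r = 0 := by
  have : profile a b =ᶠ[𝓝 r] fun _ => 0 := by
    filter_upwards [lt_mem_nhds hr] with x hx using profile_eq_zero ha hab hx.le
  rw [this.deriv_eq, deriv_const]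

/-- The profile falls monotonically from 1 to 0, so its total variation on the half-line is 1, and
the weight is at most `b ^ m` wherever the derivative is nonzero. -/
theorem integral_pow_mul_deriv_profile_le (ha : 0 ≤ a) (hab : a < b) (m : ℕ) :
    ∫ r in Ioi (0 : ℝ), r ^ m * |deriv (profile a b) r| ≤ b ^ m := by
  have hcont : Continuous (deriv (profile a b)) := (contDiff_profile a b).continuous_deriv le_rfl
  have hb : 0 < b := ha.trans_lt hab
  have h1 : ∫ r in Ioi (0 : ℝ), r ^ m * |deriv (profile a b) r|
      = ∫ r in Ioc 0 b, r ^ m * |deriv (profile a b) r| := by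
    apply setIntegral_eq_of_subset_of_forall_sdiff_eq_zero measurableSet_Ioi Ioc_subset_Ioi_self
    rintro r ⟨hr0, hr⟩
    have : b < r := by
      by_contra h
      exact hr ⟨hr0, not_lt.1 h⟩
    simp [deriv_profile_eq_zero ha hab this]
  rw [h1, ← intervalIntegral.integral_of_le hb.le]
  have h2 : ∫ r in (0 : ℝ)..b, r ^ m * |deriv (profile a b) r|
      ≤ ∫ r in (0 : ℝ)..b, b ^ m * (-deriv (profile a b) r) := by
    apply intervalIntegral.integral_mono_on hb.le
    · exact Continuous.intervalIntegrable (by fun_prop) _ _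
    · exact Continuous.intervalIntegrable (by fun_prop) _ _
    · intro r hr
      rw [abs_of_nonpos (deriv_profile_nonpos ha hab hr.1)]
      exact mul_le_mul_of_nonneg_right (pow_le_pow_left₀ hr.1 hr.2 m)
        (neg_nonneg.2 (deriv_profile_nonpos ha hab hr.1))
  refine h2.trans_eq ?_
  rw [intervalIntegral.integral_const_mul, intervalIntegral.integral_neg,
    intervalIntegral.integral_deriv_eq_sub]
  · rw [profile_eq_zero ha hab le_rfl, profile_eq_one ha hab le_rfl ha]
    simp
  · intro x _
    exact (contDiff_profile a b).differentiable (by norm_num) x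
  · exact hcont.intervalIntegrable _ _

end Profile

section Ramp

variable {n : ℕ} {a b : ℝ} (c : Euc n)

theorem contDiff_ramp (a b : ℝ) : ContDiff ℝ 1 (ramp c a b) := by
  unfold ramp profile
  refine Real.smoothTransition.contDiff.comp ?_
  have : ContDiff ℝ 1 fun x : Euc n => ‖x - c‖ ^ 2 := (contDiff_id.sub contDiff_const).norm_sq ℝ
  fun_prop

theorem ramp_nonneg (a b : ℝ) (x : Euc n) : 0 ≤ ramp c a b x := profile_nonneg _ _ _

theorem ramp_le_one (a b : ℝ) (x : Euc n) : ramp c a b x ≤ 1 := profile_le_one _ _ _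

theorem ramp_eq_one (ha : 0 ≤ a) (hab : a < b) {x : Euc n} (hx : ‖x - c‖ ≤ a) :
    ramp c a b x = 1 := profile_eq_one ha hab (norm_nonneg _) hx

theorem ramp_eq_zero (ha : 0 ≤ a) (hab : a < b) {x : Euc n} (hx : b ≤ ‖x - c‖) :
    ramp c a b x = 0 := profile_eq_zero ha hab hx

theorem norm_fderiv_ramp_le (ha : 0 ≤ a) (hab : a < b) (x : Euc n) :
    ‖fderiv ℝ (ramp c a b) x‖ ≤ |deriv (profile a b) ‖x - c‖| := by
  have h1 : HasDerivAt Real.smoothTransition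
      (deriv Real.smoothTransition ((b ^ 2 - ‖x - c‖ ^ 2) / (b ^ 2 - a ^ 2)))
      ((b ^ 2 - ‖x - c‖ ^ 2) / (b ^ 2 - a ^ 2)) :=
    ((Real.smoothTransition.contDiff (n := 1)).differentiable (by norm_num) _).hasDerivAt
  have h2 : HasFDerivAt (fun x : Euc n => (b ^ 2 - ‖x - c‖ ^ 2) / (b ^ 2 - a ^ 2))
      ((b ^ 2 - a ^ 2)⁻¹ • (-((2 : ℕ) • innerSL ℝ (x - c)) : Euc n →L[ℝ] ℝ)) x := by
    have h3 : HasFDerivAt (fun x : Euc n => ‖x - c‖ ^ 2) ((2 : ℕ) • innerSL ℝ (x - c)) x := by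
      have := ((hasFDerivAt_id x).sub_const c).norm_sq
      simpa using this
    have := (h3.const_sub (b ^ 2)).const_smul (b ^ 2 - a ^ 2)⁻¹
    refine this.congr_of_eventuallyEq (Eventually.of_forall fun y => ?_)
    simp [div_eq_inv_mul]
  have h4 := h1.comp_hasFDerivAt x h2
  change ‖fderiv ℝ (Real.smoothTransition ∘ fun x : Euc n =>
    (b ^ 2 - ‖x - c‖ ^ 2) / (b ^ 2 - a ^ 2)) x‖ ≤ _
  rw [h4.fderiv, deriv_profile, norm_smul, norm_smul, norm_neg, abs_mul, Real.norm_eq_abs]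
  have hpos := sq_sub_sq_pos ha hab
  have h5 : ‖(2 : ℕ) • innerSL ℝ (x - c)‖ ≤ 2 * ‖x - c‖ := by
    refine (norm_nsmul_le ..).trans ?_
    rw [innerSL_apply_norm]
    norm_num
  gcongr
  rw [abs_div, abs_neg, abs_of_nonneg (by positivity : 0 ≤ 2 * ‖x - c‖), abs_of_pos hpos,
    norm_inv, Real.norm_of_nonneg hpos.le, div_eq_inv_mul]
  gcongr

/-- Polar coordinates reduce this to the profile. Only the outer radius enters the bound, so the
transition layer can be made arbitrarily thin. -/
theorem lintegral_fderiv_ramp_le (hn : 3 ≤ n) (ha : 0 ≤ a) (hab : a < b) :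
    ∫⁻ x, ‖fderiv ℝ (ramp c a b) x‖ₑ ≤ ENNReal.ofReal (sphereArea n * b ^ (n - 1)) := by
  have : Nontrivial (Euc n) := by
    have : Nonempty (Fin n) := ⟨⟨0, by omega⟩⟩
    infer_instance
  have hcont : Continuous (deriv (profile a b)) := (contDiff_profile a b).continuous_deriv le_rfl
  have hint : Integrable fun x : Euc n => |deriv (profile a b) ‖x‖| := by
    apply Continuous.integrable_of_hasCompactSupport (by fun_prop)
    apply HasCompactSupport.intro (isCompact_closedBall (0 : Euc n) b)
    intro x hx
    rw [deriv_profile_eq_zero ha hab (by simpa using hx), abs_zero]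
  calc ∫⁻ x, ‖fderiv ℝ (ramp c a b) x‖ₑ
      ≤ ∫⁻ x, ENNReal.ofReal |deriv (profile a b) ‖x - c‖| := by
        refine lintegral_mono fun x => ?_
        rw [← ofReal_norm]
        exact ENNReal.ofReal_le_ofReal (norm_fderiv_ramp_le c ha hab x)
    _ = ∫⁻ x : Euc n, ENNReal.ofReal |deriv (profile a b) ‖x‖| :=
        lintegral_sub_right_eq_self (fun x : Euc n => ENNReal.ofReal |deriv (profile a b) ‖x‖|) c
    _ = ENNReal.ofReal (∫ x : Euc n, |deriv (profile a b) ‖x‖|) :=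
        (ofReal_integral_eq_lintegral_ofReal hint (Eventually.of_forall fun _ => abs_nonneg _)).symm
    _ ≤ _ := by
        apply ENNReal.ofReal_le_ofReal
        rw [integral_fun_norm_addHaar volume (fun r => |deriv (profile a b) r|)]
        simp only [finrank_euclideanSpace, Fintype.card_fin, nsmul_eq_mul, smul_eq_mul]
        rw [sphereArea, mul_assoc]
        exact mul_le_mul_of_nonneg_left (mul_le_mul_of_nonneg_left
          (integral_pow_mul_deriv_profile_le ha hab _) ENNReal.toReal_nonneg) n.cast_nonneg

end Ramp

end IsoMass

end

/-! ### The Riemannian volume in an arbitrary coordinate system. -/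

noncomputable section

namespace IsoMass

/-- In matrices the pulled-back form is `AᵀBA`. After the square root, the factor `J.det ^ 2`
becomes the Jacobian of the change of variables. -/
theorem det_gram_comp {n : ℕ} (B : Euc n →L[ℝ] Euc n →L[ℝ] ℝ) (J : Euc n →L[ℝ] Euc n) :
    (Matrix.of fun i j => B (J (stdVec i)) (J (stdVec j))).det =
      J.det ^ 2 * (Matrix.of fun i j => B (stdVec i) (stdVec j)).det := by
  classical
  let b := (EuclideanSpace.basisFun (Fin n) ℝ).toBasis
  let A := LinearMap.toMatrix b b (J : Euc n →ₗ[ℝ] Euc n)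
  have hJ (i : Fin n) : J (stdVec i) = ∑ k, A k i • stdVec k := by
    have := b.sum_repr (J (stdVec i))
    rw [← this]
    refine Finset.sum_congr rfl fun k _ => ?_
    simp [A, b, LinearMap.toMatrix_apply]
  have h : (Matrix.of fun i j => B (J (stdVec i)) (J (stdVec j))) =
      A.transpose * (Matrix.of fun i j => B (stdVec i) (stdVec j)) * A := by
    ext i j
    simp only [Matrix.of_apply, hJ, map_sum, map_smul, sum_apply,
      smul_apply, Matrix.mul_apply, Matrix.transpose_apply, smul_eq_mul,
      Finset.mul_sum, Finset.sum_mul]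
    refine Finset.sum_congr rfl fun k _ => Finset.sum_congr rfl fun l _ => by ring
  have hdet : A.det = J.det := LinearMap.det_toMatrix b _
  rw [h, Matrix.det_mul, Matrix.det_mul, Matrix.det_transpose, hdet]
  ring

variable {n : ℕ} {H : Type*} [TopologicalSpace H] {I : ModelWithCorners ℝ (Euc n) H}
  {M : Type*} [TopologicalSpace M] [ChartedSpace H M] [IsManifold I ∞ M]
  (g : C0Metric I M)

/-- The components of the metric in a parametrization `ψ` with domain `t`. -/
def gramAlong (ψ : Euc n → M) (t : Set (Euc n)) (x : Euc n) : Matrix (Fin n) (Fin n) ℝ :=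
  Matrix.of fun i j =>
    g.inner (ψ x) (mfderivWithin 𝓘(ℝ, Euc n) I ψ t x (stdVec i))
      (mfderivWithin 𝓘(ℝ, Euc n) I ψ t x (stdVec j))

variable (I) in
/-- `e` is a local coordinate system, the inverse of which is differentiable within `t`. -/
structure IsCoord (e : PartialEquiv M (Euc n)) (t : Set (Euc n)) : Prop where
  isOpen_source : IsOpen e.source
  measurableSet_target : MeasurableSet e.target
  continuousOn_symm : ContinuousOn e.symm e.target
  subset : e.target ⊆ t
  mdiff : ∀ x ∈ e.target, MDifferentiableWithinAt 𝓘(ℝ, Euc n) I e.symm t x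

theorem isCoord_extChartAt (p : M) : IsCoord I (extChartAt I p) (range I) where
  isOpen_source := isOpen_extChartAt_source p
  measurableSet_target := by
    rw [extChartAt_target]
    exact (I.continuous_symm.isOpen_preimage _ (chartAt H p).open_target).measurableSet.inter
      I.isClosed_range.measurableSet
  continuousOn_symm := continuousOn_extChartAt_symm p
  subset := extChartAt_target_subset_range p
  mdiff _ hx := mdifferentiableWithinAt_extChartAt_symm hx

variable [MeasurableSpace M] [BorelSpace M]

/-- The volume in a coordinate system. -/
def coordVolume (e : PartialEquiv M (Euc n)) (t : Set (Euc n)) : Measure M :=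
  ((volume.restrict e.target).withDensity
    fun x => ENNReal.ofReal (Real.sqrt (gramAlong g e.symm t x).det)).map e.symm

omit [BorelSpace M] in
theorem chartVolume_eq (p : M) : chartVolume g p = coordVolume g (extChartAt I p) (range I) := rfl

variable {g} {e : PartialEquiv M (Euc n)} {t : Set (Euc n)}

omit [IsManifold I ∞ M] in
theorem IsCoord.measurableSet_preimage (he : IsCoord I e t) {A : Set M} (hA : MeasurableSet A) :
    MeasurableSet (e.symm ⁻¹' A ∩ e.target) := by
  have h : Measurable (e.target.domRestrict e.symm) :=
    (continuousOn_iff_continuous_domRestrict.1 he.continuousOn_symm).measurable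
  have := he.measurableSet_target.subtype_image (h hA)
  convert this using 1
  ext x
  simp [and_comm, domRestrict]

theorem IsCoord.coordVolume_apply (he : IsCoord I e t) {A : Set M} (hA : MeasurableSet A) :
    coordVolume g e t A = ∫⁻ x in e.symm ⁻¹' A ∩ e.target,
      ENNReal.ofReal (Real.sqrt (gramAlong g e.symm t x).det) := by
  have hm : AEMeasurable e.symm (volume.restrict e.target) :=
    he.continuousOn_symm.aemeasurable he.measurableSet_target
  rw [coordVolume, Measure.map_apply_of_aemeasurable
    (hm.mono_ac (withDensity_absolutelyContinuous _ _)) hA, withDensity_apply',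
    Measure.restrict_restrict' he.measurableSet_target]

-- `J` is the derivative of the coordinate change. Since the differential of the inverse preferred
-- chart undoes that of the chart, the Gram matrix along `e` is the preferred one pulled back by
-- `J`.
omit [MeasurableSpace M] [BorelSpace M] in
theorem IsCoord.sqrt_det_gramAlong (he : IsCoord I e t) (p : M) {x : Euc n} (hx : x ∈ e.target)
    (hxp : e.symm x ∈ (extChartAt I p).source) :
    ∃ J : Euc n →L[ℝ] Euc n, HasFDerivWithinAt (extChartAt I p ∘ e.symm) J t x ∧
      Real.sqrt (gramAlong g e.symm t x).det =
        |J.det| * Real.sqrt (gramMatrix g p (extChartAt I p (e.symm x))).det := by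
  set y := e.symm x with hy
  have hyc : y ∈ (chartAt H p).source := by rwa [← extChartAt_source I]
  have h1 := (he.mdiff x hx).hasMFDerivWithinAt
  have h2 := (mdifferentiableAt_extChartAt (I := I) hyc).hasMFDerivAt
  have h3 := h2.comp_hasMFDerivWithinAt x h1
  let J : Euc n →L[ℝ] Euc n := (mfderiv I 𝓘(ℝ, Euc n) (extChartAt I p) y).comp
    (mfderivWithin 𝓘(ℝ, Euc n) I e.symm t x)
  refine ⟨J, h3.hasFDerivWithinAt, ?_⟩
  set z := extChartAt I p y with hz
  have hsymm : (extChartAt I p).symm z = y := (extChartAt I p).left_inv hxp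
  let G : M → Euc n →L[ℝ] Euc n →L[ℝ] ℝ := fun q => g.inner q
  let L : Euc n →L[ℝ] Euc n :=
    mfderivWithin 𝓘(ℝ, Euc n) I (extChartAt I p).symm (range I) z
  let D : Euc n →L[ℝ] Euc n := mfderivWithin 𝓘(ℝ, Euc n) I e.symm t x
  have hLJ (v : Euc n) : L (J v) = D v := by
    have := mfderivWithin_extChartAt_symm_comp_mfderiv_extChartAt' (I := I) hxp
    exact DFunLike.congr_fun this (D v)
  have hG : gramMatrix g p z = Matrix.of fun i j => G y (L (stdVec i)) (L (stdVec j)) := by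
    rw [← hsymm]; rfl
  have hA : gramAlong g e.symm t x = Matrix.of fun i j => G y (D (stdVec i)) (D (stdVec j)) := rfl
  let B : Euc n →L[ℝ] Euc n →L[ℝ] ℝ := (G y).bilinearComp L L
  have := det_gram_comp B J
  have h5 : (gramAlong g e.symm t x).det = J.det ^ 2 * (gramMatrix g p z).det := by
    have hB : gramMatrix g p z = Matrix.of fun i j => B (stdVec i) (stdVec j) := hG
    rw [hA, hB, ← this]
    congr 1
    ext i j
    simp only [B, ContinuousLinearMap.bilinearComp_apply, hLJ]
  rw [h5, Real.sqrt_mul (sq_nonneg _), Real.sqrt_sq_eq_abs]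

/-- This is the change of variables formula. Derivatives are taken within `t`, so charts at the
boundary, where `t` is `range I`, are covered as well. -/
theorem IsCoord.coordVolume_eq_chartVolume (he : IsCoord I e t) (p : M) {A : Set M}
    (hA : MeasurableSet A) (hAe : A ⊆ e.source) (hAp : A ⊆ (extChartAt I p).source) :
    coordVolume g e t A = chartVolume g p A := by
  rw [chartVolume_eq, he.coordVolume_apply hA, (isCoord_extChartAt p).coordVolume_apply hA]
  set S := e.symm ⁻¹' A ∩ e.target with hS
  have hSm : MeasurableSet S := he.measurableSet_preimage hA
  have himage : (extChartAt I p).symm ⁻¹' A ∩ (extChartAt I p).target =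
      (extChartAt I p ∘ e.symm) '' S := by
    ext z
    constructor
    · rintro ⟨hz, hzt⟩
      refine ⟨e ((extChartAt I p).symm z), ⟨?_, e.map_source (hAe hz)⟩, ?_⟩
      · rwa [mem_preimage, e.left_inv (hAe hz)]
      · rw [Function.comp_apply, e.left_inv (hAe hz), (extChartAt I p).right_inv hzt]
    · rintro ⟨x, ⟨hx, hxt⟩, rfl⟩
      exact ⟨by rwa [mem_preimage, Function.comp_apply, (extChartAt I p).left_inv (hAp hx)],
        (extChartAt I p).map_source (hAp hx)⟩
  have hJ : ∀ x ∈ S, ∃ J : Euc n →L[ℝ] Euc n,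
      HasFDerivWithinAt (extChartAt I p ∘ e.symm) J t x ∧
      Real.sqrt (gramAlong g e.symm t x).det =
        |J.det| * Real.sqrt (gramMatrix g p (extChartAt I p (e.symm x))).det :=
    fun x hx => he.sqrt_det_gramAlong p hx.2 (hAp hx.1)
  choose! J hJ1 hJ2 using hJ
  have hinj : InjOn (extChartAt I p ∘ e.symm) S :=
    ((extChartAt I p).injOn.mono hAp).comp (e.symm.injOn.mono inter_subset_right)
      fun x hx => hx.1
  rw [himage, lintegral_image_eq_lintegral_abs_det_fderiv_mul volume hSm
    (fun x hx => (hJ1 x hx).mono (inter_subset_right.trans he.subset)) hinj]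
  refine setLIntegral_congr_fun hSm fun x hx => ?_
  rw [← ENNReal.ofReal_mul (abs_nonneg _)]
  exact congrArg ENNReal.ofReal (hJ2 x hx)

theorem chartVolume_le_of_subset (p q : M) {A : Set M} (hA : MeasurableSet A)
    (hAp : A ⊆ (extChartAt I p).source) : chartVolume g q A ≤ chartVolume g p A := by
  have hq := isCoord_extChartAt (I := I) q
  have h : chartVolume g q A = chartVolume g q (A ∩ (extChartAt I q).source) := by
    rw [chartVolume_eq, hq.coordVolume_apply hA,
      hq.coordVolume_apply (hA.inter hq.isOpen_source.measurableSet)]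
    congr 2
    ext x
    simp only [mem_inter_iff, mem_preimage]
    constructor
    · exact fun h => ⟨⟨h.1, (extChartAt I q).map_target h.2⟩, h.2⟩
    · exact fun h => ⟨h.1.1, h.2⟩
  rw [h, chartVolume_eq g q, hq.coordVolume_eq_chartVolume p
    (hA.inter hq.isOpen_source.measurableSet) inter_subset_right (inter_subset_left.trans hAp)]
  exact measure_mono inter_subset_left

variable [SecondCountableTopology M]

theorem exists_measurable_partition_extChartAt [Nonempty M] (I : ModelWithCorners ℝ (Euc n) H)
    [IsManifold I ∞ M] :
    ∃ (p : ℕ → M) (A : ℕ → Set M), (∀ k, MeasurableSet (A k)) ∧ Pairwise (Function.onFun Disjoint A) ∧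
      (⋃ k, A k = univ) ∧ ∀ k, A k ⊆ (extChartAt I (p k)).source := by
  obtain ⟨s, hs, hcov⟩ := TopologicalSpace.countable_cover_nhds
    (fun p : M => extChartAt_source_mem_nhds (I := I) p)
  have hne : s.Nonempty := by
    by_contra h
    rw [not_nonempty_iff_eq_empty] at h
    simp [h] at hcov
    exact empty_ne_univ hcov
  obtain ⟨p, rfl⟩ := hs.exists_eq_range hne
  refine ⟨p, disjointed fun k => (extChartAt I (p k)).source, fun k => ?_,
    disjoint_disjointed _, ?_, fun k => disjointed_subset _ k⟩
  · exact MeasurableSet.disjointed (fun k => (isOpen_extChartAt_source (p k)).measurableSet) k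
  · rw [iUnion_disjointed]
    simpa using hcov

/-- A countable partition subordinate to chart domains glues chart volumes into one measure `ν`. It
dominates every chart volume, hence their supremum, and on `A` it is at most the volume of the chart
at `p`, piece by piece. -/
theorem riemVolume_apply_of_subset (p : M) {A : Set M} (hA : MeasurableSet A)
    (hAp : A ⊆ (extChartAt I p).source) : riemVolume g A = chartVolume g p A := by
  have : Nonempty M := ⟨p⟩
  apply le_antisymm
  · obtain ⟨q, D, hDm, hDd, hDu, hDs⟩ := exists_measurable_partition_extChartAt (M := M) I
    let ν : Measure M := Measure.sum fun k => (chartVolume g (q k)).restrict (D k)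
    have key (r : M) {B : Set M} (hB : MeasurableSet B) :
        chartVolume g r B = ∑' k, chartVolume g r (B ∩ D k) := by
      rw [← measure_iUnion (fun i j hij => (hDd hij).mono inter_subset_right inter_subset_right)
        (fun k => hB.inter (hDm k)), ← inter_iUnion, hDu, inter_univ]
    have hν {B : Set M} (hB : MeasurableSet B) :
        ν B = ∑' k, chartVolume g (q k) (B ∩ D k) := by
      simp only [ν, Measure.sum_apply _ hB, Measure.restrict_apply hB]
    have h1 : riemVolume g ≤ ν := by
      refine iSup_le fun r => Measure.le_iff.2 fun B hB => ?_
      rw [key r hB, hν hB]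
      exact ENNReal.tsum_le_tsum fun k => chartVolume_le_of_subset (q k) r (hB.inter (hDm k))
        (inter_subset_right.trans (hDs k))
    refine (h1 A).trans ?_
    rw [key p hA, hν hA]
    exact ENNReal.tsum_le_tsum fun k => chartVolume_le_of_subset p (q k) (hA.inter (hDm k))
        (inter_subset_left.trans hAp)
  · exact le_iSup (fun p => chartVolume g p) p A

theorem IsCoord.riemVolume_apply (he : IsCoord I e t) {A : Set M} (hA : MeasurableSet A)
    (hAe : A ⊆ e.source) : riemVolume g A = coordVolume g e t A := by
  rcases isEmpty_or_nonempty M with h | h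
  · simp [Set.eq_empty_of_isEmpty A]
  obtain ⟨q, D, hDm, hDd, hDu, hDs⟩ := exists_measurable_partition_extChartAt (M := M) I
  have key (μ : Measure M) : μ A = ∑' k, μ (A ∩ D k) := by
    rw [← measure_iUnion (fun i j hij => (hDd hij).mono inter_subset_right inter_subset_right)
      (fun k => hA.inter (hDm k)), ← inter_iUnion, hDu, inter_univ]
  rw [key (riemVolume g), key (coordVolume g e t)]
  refine tsum_congr fun k => ?_
  rw [riemVolume_apply_of_subset (q k) (hA.inter (hDm k)) (inter_subset_right.trans (hDs k)),
    he.coordVolume_eq_chartVolume (q k) (hA.inter (hDm k)) (inter_subset_left.trans hAe)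
      (inter_subset_right.trans (hDs k))]

end IsoMass

end

/-! ### Local finiteness of the volume, and calculus in the chart of the end. -/

noncomputable section

namespace IsoMass

section LocallyFinite

variable {n : ℕ} {H : Type*} [TopologicalSpace H] {I : ModelWithCorners ℝ (Euc n) H}
  {M : Type*} [TopologicalSpace M] [ChartedSpace H M] [IsManifold I ∞ M]
  (g : C0Metric I M)

/-- The coordinate fields of the chart at `p` are the constant sections of the tangent
trivialization at `p`, hence continuous, and the metric is a continuous section. Continuity at the
base point alone already bounds the density nearby. -/
theorem continuousAt_gramMatrix (p : M) :
    ContinuousAt (fun y => gramMatrix g p (extChartAt I p y)) p := by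
  let σ : Fin n → (y : M) → TangentSpace I y := fun i y =>
    (trivializationAt (Euc n) (TangentSpace I) p).symmL ℝ y (stdVec i)
  have hp : p ∈ (trivializationAt (Euc n) (TangentSpace I) p).baseSet :=
    FiberBundle.mem_baseSet_trivializationAt' p
  have hσ (i : Fin n) : ContinuousAt (fun y => TotalSpace.mk' (Euc n) y (σ i y)) p := by
    have h1 := (trivializationAt (Euc n) (TangentSpace I : M → Type _) p).continuousOn_symm
    have h2 := h1.continuousAt (x := (p, stdVec i)) ((((trivializationAt (Euc n)
      (TangentSpace I : M → Type _) p).open_baseSet.prod isOpen_univ).mem_nhds ⟨hp, trivial⟩))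
    have h3 : ContinuousAt (fun y : M => (y, (stdVec i : Euc n))) p := by fun_prop
    refine (h2.comp (f := fun y : M => (y, (stdVec i : Euc n))) h3).congr ?_
    filter_upwards [(trivializationAt (Euc n)
      (TangentSpace I : M → Type _) p).open_baseSet.mem_nhds hp] with y hy
    exact congrArg (TotalSpace.mk' (Euc n) y) (Trivialization.symmL_apply _ hy _).symm
  refine continuousAt_pi.2 fun i => continuousAt_pi.2 fun j => ?_
  have h3 := ContinuousAt.clm_bundle_apply₂ (F₁ := Euc n) (F₂ := Euc n) (F₃ := ℝ)
    (E₃ := Bundle.Trivial M ℝ) g.continuous.continuousAt (hσ i) (hσ j)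
  have h4 : ContinuousAt (fun y => g.inner y (σ i y) (σ j y)) p := by
    simp only [FiberBundle.continuousAt_totalSpace] at h3
    exact h3.2
  refine h4.congr ?_
  filter_upwards [extChartAt_source_mem_nhds (I := I) p] with y hy
  have hyc : y ∈ (chartAt H p).source := by rwa [← extChartAt_source I]
  have h5 := TangentBundle.symmL_trivializationAt (I := I) hyc
  simp only [σ, h5, gramMatrix, Matrix.of_apply]
  rw [(extChartAt I p).left_inv hy]
  rfl

variable [MeasurableSpace M] [BorelSpace M] [SecondCountableTopology M]

instance isLocallyFiniteMeasure_riemVolume : IsLocallyFiniteMeasure (riemVolume g) := by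
  refine ⟨fun p => ?_⟩
  have h1 : ContinuousAt (fun y => Real.sqrt (gramMatrix g p (extChartAt I p y)).det) p :=
    Real.continuous_sqrt.continuousAt.comp
      ((Continuous.matrix_det continuous_id).continuousAt.comp (continuousAt_gramMatrix g p))
  set C := Real.sqrt (gramMatrix g p (extChartAt I p p)).det + 1
  have h2 : ∀ᶠ y in 𝓝 p, Real.sqrt (gramMatrix g p (extChartAt I p y)).det < C :=
    h1.eventually_lt continuousAt_const (lt_add_one _)
  have h3 : ∀ᶠ y in 𝓝 p, extChartAt I p y ∈ Metric.ball (extChartAt I p p) 1 :=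
    (continuousAt_extChartAt p).eventually (Metric.ball_mem_nhds _ one_pos)
  obtain ⟨U, hU, hUo, hpU⟩ := eventually_nhds_iff.1
    (h2.and (h3.and (extChartAt_source_mem_nhds (I := I) p)))
  refine ⟨U, hUo.mem_nhds hpU, ?_⟩
  rw [riemVolume_apply_of_subset p hUo.measurableSet fun y hy => (hU y hy).2.2, chartVolume_eq,
    (isCoord_extChartAt p).coordVolume_apply hUo.measurableSet]
  have hS := (isCoord_extChartAt (I := I) p).measurableSet_preimage hUo.measurableSet
  calc _ ≤ ∫⁻ _ in (extChartAt I p).symm ⁻¹' U ∩ (extChartAt I p).target, ENNReal.ofReal C := by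
        refine setLIntegral_mono' hS fun x hx => ENNReal.ofReal_le_ofReal ?_
        have := (hU _ hx.1).1
        rw [(extChartAt I p).right_inv hx.2] at this
        exact this.le
    _ ≤ ∫⁻ _ in Metric.ball (extChartAt I p p) 1, ENNReal.ofReal C := by
        refine lintegral_mono_set fun x hx => ?_
        have := (hU _ hx.1).2.1
        rwa [(extChartAt I p).right_inv hx.2] at this
    _ < ⊤ := by
        rw [setLIntegral_const]
        exact ENNReal.mul_lt_top ENNReal.ofReal_lt_top measure_ball_lt_top

end LocallyFinite

section Filling

variable {n : ℕ} {H : Type*} [TopologicalSpace H] {I : ModelWithCorners ℝ (Euc n) H}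
  {M : Type*} [TopologicalSpace M] [ChartedSpace H M] [IsManifold I ∞ M]
  {g : C0Metric I M} {E : AFEnd n} (F : Filling E g)

namespace Filling

theorem R_pos : 0 < F.R := E.r₀_pos.trans_le F.r₀_le

theorem mem_source {p : M} : p ∈ F.chart.source ↔ p ∉ F.core := by
  rw [F.source_eq, mem_compl_iff]

theorem mem_target {x : Euc n} : x ∈ F.chart.target ↔ F.R < ‖x‖ := by
  rw [F.target_eq, mem_ofPred_eq]

theorem symm_notMem_core {x : Euc n} (hx : F.R < ‖x‖) : F.chart.symm x ∉ F.core :=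
  F.mem_source.1 (F.chart.map_target (F.mem_target.2 hx))

theorem chart_symm {x : Euc n} (hx : F.R < ‖x‖) : F.chart (F.chart.symm x) = x :=
  F.chart.right_inv (F.mem_target.2 hx)

theorem symm_chart {p : M} (hp : p ∉ F.core) : F.chart.symm (F.chart p) = p :=
  F.chart.left_inv (F.mem_source.2 hp)

theorem mdifferentiableAt_symm {x : Euc n} (hx : F.R < ‖x‖) :
    MDifferentiableAt 𝓘(ℝ, Euc n) I F.chart.symm x :=
  ((F.contMDiffOn_symm x (F.mem_target.2 hx)).contMDiffAt
    (F.chart.open_target.mem_nhds (F.mem_target.2 hx))).mdifferentiableAt (by simp)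

theorem mdifferentiableAt_chart {p : M} (hp : p ∉ F.core) :
    MDifferentiableAt I 𝓘(ℝ, Euc n) F.chart p :=
  ((F.contMDiffOn_chart p (F.mem_source.2 hp)).contMDiffAt
    (F.chart.open_source.mem_nhds (F.mem_source.2 hp))).mdifferentiableAt (by simp)

theorem isCoord : IsCoord I F.chart.toPartialEquiv univ where
  isOpen_source := F.chart.open_source
  measurableSet_target := F.chart.open_target.measurableSet
  continuousOn_symm := F.chart.continuousOn_symm
  subset := subset_univ _
  mdiff _ hx := (F.mdifferentiableAt_symm (F.mem_target.1 hx)).mdifferentiableWithinAt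

theorem gramAlong_symm {x : Euc n} (hx : F.R < ‖x‖) :
    gramAlong g F.chart.symm univ x = E.coeff x := by
  ext i j
  simp only [gramAlong, mfderivWithin_univ, Matrix.of_apply]
  exact F.metric_eq x hx i j

/-- The coordinate density of the Riemannian volume of the end. -/
def _root_.IsoMass.AFEnd.density (E : AFEnd n) (x : Euc n) : ℝ≥0∞ :=
  ENNReal.ofReal (Real.sqrt (E.coeff x).det)

theorem aemeasurable_density : AEMeasurable E.density (volume.restrict F.chart.target) := by
  apply ContinuousOn.aemeasurable _ F.chart.open_target.measurableSet
  apply ENNReal.continuous_ofReal.comp_continuousOn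
  apply Real.continuous_sqrt.comp_continuousOn
  apply (Continuous.matrix_det continuous_id).comp_continuousOn
  refine E.continuousOn_coeff.mono fun x hx => ?_
  exact F.r₀_le.trans_lt (F.mem_target.1 hx)

theorem inner_mfderiv_symm {x : Euc n} (hx : F.R < ‖x‖) (w : Euc n) :
    g.inner (F.chart.symm x) (mfderiv 𝓘(ℝ, Euc n) I F.chart.symm x w)
      (mfderiv 𝓘(ℝ, Euc n) I F.chart.symm x w) = ∑ i, ∑ j, E.coeff x i j * w i * w j := by
  let B : Euc n →L[ℝ] Euc n →L[ℝ] ℝ := g.inner (F.chart.symm x)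
  let D : Euc n →L[ℝ] Euc n := mfderiv 𝓘(ℝ, Euc n) I F.chart.symm x
  have h : w = ∑ i, w i • (stdVec i : Euc n) := by
    have := (EuclideanSpace.basisFun (Fin n) ℝ).toBasis.sum_repr w
    simpa using this.symm
  have hB (i j : Fin n) : B (D (stdVec i)) (D (stdVec j)) = E.coeff x i j := F.metric_eq x hx i j
  change B (D w) (D w) = _
  conv_lhs => rw [h]
  simp only [map_sum, map_smul, sum_apply, smul_apply, smul_eq_mul, hB, Finset.mul_sum]
  rw [Finset.sum_comm]
  refine Finset.sum_congr rfl fun i _ => Finset.sum_congr rfl fun j _ => by ring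

theorem mfderiv_symm_mfderiv_chart {x : Euc n} (hx : F.R < ‖x‖)
    (v : TangentSpace I (F.chart.symm x)) :
    mfderiv 𝓘(ℝ, Euc n) I F.chart.symm x (mfderiv I 𝓘(ℝ, Euc n) F.chart (F.chart.symm x) v)
      = v := by
  have hp := F.symm_notMem_core hx
  have h1 : MDifferentiableAt 𝓘(ℝ, Euc n) I F.chart.symm (F.chart (F.chart.symm x)) := by
    rw [F.chart_symm hx]
    exact F.mdifferentiableAt_symm hx
  have h2 := h1.hasMFDerivAt.comp _ (F.mdifferentiableAt_chart hp).hasMFDerivAt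
  have h3 : HasMFDerivAt I I (F.chart.symm ∘ F.chart) (F.chart.symm x)
      (ContinuousLinearMap.id ℝ (TangentSpace I (F.chart.symm x))) := by
    refine (hasMFDerivAt_id _).congr_of_eventuallyEq ?_
    filter_upwards [F.chart.open_source.mem_nhds (F.mem_source.2 hp)] with q hq
    exact F.chart.left_inv hq
  have h4 := DFunLike.congr_fun (hasMFDerivAt_unique h2 h3) v
  rw [ContinuousLinearMap.comp_apply] at h4
  conv_rhs => rw [← show _ = v from h4]
  rw [F.chart_symm hx]

variable [MeasurableSpace M] [BorelSpace M] [SecondCountableTopology M]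

theorem riemVolume_apply {A : Set M} (hA : MeasurableSet A) (hAc : Disjoint A F.core) :
    riemVolume g A = ∫⁻ x in F.chart.symm ⁻¹' A ∩ F.chart.target, E.density x := by
  have hA' : A ⊆ F.chart.toPartialEquiv.source := fun p hp =>
    F.mem_source.2 (disjoint_left.1 hAc hp)
  rw [F.isCoord.riemVolume_apply hA hA', F.isCoord.coordVolume_apply hA]
  refine setLIntegral_congr_fun (F.isCoord.measurableSet_preimage hA) fun x hx => ?_
  have := F.gramAlong_symm (F.mem_target.1 hx.2)
  simp only [AFEnd.density]
  rw [← this]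
  rfl

/-- The function `f` will be a gradient norm, whose measurability is never established. Every step
therefore holds for arbitrary `f`, and only the majorant `φ` is measurable. -/
theorem lintegral_le [T2Space M] {f : M → ℝ≥0∞} {φ : Euc n → ℝ≥0∞} (hφ : Measurable φ)
    (h0 : ∀ p ∈ F.core, f p = 0) (h1 : ∀ x, F.R < ‖x‖ → f (F.chart.symm x) ≤ φ x) :
    ∫⁻ p, f p ∂(riemVolume g) ≤ ∫⁻ x in F.chart.target, E.density x * φ x := by
  have hcore : MeasurableSet F.core := F.isCompact_core.measurableSet
  have hle : (riemVolume g).restrict F.coreᶜ ≤ coordVolume g F.chart.toPartialEquiv univ := by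
    refine Measure.le_iff.2 fun B hB => ?_
    rw [Measure.restrict_apply hB, F.isCoord.riemVolume_apply (hB.inter hcore.compl)
      (inter_subset_right.trans F.source_eq.symm.subset)]
    exact measure_mono inter_subset_left
  have hd : (volume.restrict F.chart.target).withDensity
      (fun x => ENNReal.ofReal (Real.sqrt (gramAlong g F.chart.symm univ x).det)) =
      (volume.restrict F.chart.target).withDensity E.density := by
    apply withDensity_congr_ae
    filter_upwards [ae_restrict_mem F.chart.open_target.measurableSet] with x hx
    rw [F.gramAlong_symm (F.mem_target.1 hx)]
    rfl
  calc ∫⁻ p, f p ∂(riemVolume g)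
      = ∫⁻ p in F.core, f p ∂(riemVolume g) + ∫⁻ p in F.coreᶜ, f p ∂(riemVolume g) :=
        (lintegral_add_compl f hcore).symm
    _ = ∫⁻ p in F.coreᶜ, f p ∂(riemVolume g) := by
        rw [setLIntegral_congr_fun hcore h0]; simp
    _ ≤ ∫⁻ p, f p ∂(coordVolume g F.chart.toPartialEquiv univ) := lintegral_mono' hle le_rfl
    _ ≤ ∫⁻ x, f (F.chart.symm x) ∂((volume.restrict F.chart.target).withDensity E.density) := by
        rw [← hd]
        exact lintegral_map_le _ _
    _ ≤ ∫⁻ x, φ x ∂((volume.restrict F.chart.target).withDensity E.density) := by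
        apply lintegral_mono_ae
        apply (withDensity_absolutelyContinuous _ _).ae_le
        filter_upwards [ae_restrict_mem F.chart.open_target.measurableSet] with x hx
        exact h1 x (F.mem_target.1 hx)
    _ = ∫⁻ x in F.chart.target, E.density x * φ x :=
        lintegral_withDensity_eq_lintegral_mul₀ F.aemeasurable_density hφ.aemeasurable

end Filling

end Filling

end IsoMass

end

/-! ### Near-Euclidean coefficients, and connectedness of exterior regions. -/

noncomputable section

namespace IsoMass

/-- The coefficient matrix `a` is Euclidean up to the factors `1 ± δ` in volume and length. -/
structure IsNearEuclidean {n : ℕ} (a : Matrix (Fin n) (Fin n) ℝ) (δ : ℝ) : Prop where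
  le_sqrt_det : 1 - δ ≤ Real.sqrt a.det
  sqrt_det_le : Real.sqrt a.det ≤ 1 + δ
  norm_sq_le : ∀ w : Euc n, ‖w‖ ^ 2 ≤ (1 + δ) ^ 2 * ∑ i, ∑ j, a i j * w i * w j

theorem abs_quadratic_sub_norm_sq_le {n : ℕ} {a : Matrix (Fin n) (Fin n) ℝ} {ε : ℝ}
    (ha : ∀ i j, |a i j - (1 : Matrix (Fin n) (Fin n) ℝ) i j| ≤ ε) (w : Euc n) :
    |∑ i, ∑ j, a i j * w i * w j - ‖w‖ ^ 2| ≤ ε * n * ‖w‖ ^ 2 := by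
  have h1 : ∑ i, ∑ j, a i j * w i * w j - ‖w‖ ^ 2 =
      ∑ i, ∑ j, (a i j - (1 : Matrix (Fin n) (Fin n) ℝ) i j) * w i * w j := by
    simp only [sub_mul, Finset.sum_sub_distrib, EuclideanSpace.real_norm_sq_eq]
    congr 1
    refine Finset.sum_congr rfl fun i _ => ?_
    simp [Matrix.one_apply, sq]
  have h2 : (∑ i, |w i|) ^ 2 ≤ n * ‖w‖ ^ 2 := by
    have := sq_sum_le_card_mul_sum_sq (s := Finset.univ) (f := fun i => |w i|)
    simpa [EuclideanSpace.real_norm_sq_eq] using this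
  rcases isEmpty_or_nonempty (Fin n) with h | ⟨⟨i⟩⟩
  · rw [h1]; simp [EuclideanSpace.real_norm_sq_eq]
  have hε : 0 ≤ ε := (abs_nonneg _).trans (ha i i)
  calc |∑ i, ∑ j, a i j * w i * w j - ‖w‖ ^ 2|
      ≤ ∑ i, ∑ j, ε * (|w i| * |w j|) := by
        rw [h1]
        refine (Finset.abs_sum_le_sum_abs _ _).trans (Finset.sum_le_sum fun i _ => ?_)
        refine (Finset.abs_sum_le_sum_abs _ _).trans (Finset.sum_le_sum fun j _ => ?_)
        rw [abs_mul, abs_mul, mul_assoc]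
        exact mul_le_mul_of_nonneg_right (ha i j) (by positivity)
    _ = ε * (∑ i, |w i|) ^ 2 := by
        rw [sq, Finset.sum_mul_sum]
        simp only [Finset.mul_sum]
    _ ≤ ε * n * ‖w‖ ^ 2 := by
        rw [mul_assoc]
        exact mul_le_mul_of_nonneg_left h2 hε

theorem AFEnd.tendsto_coeff {n : ℕ} (E : AFEnd n) (i j : Fin n) :
    Tendsto (fun x => E.coeff x i j) (comap norm atTop)
      (𝓝 ((1 : Matrix (Fin n) (Fin n) ℝ) i j)) := by
  obtain ⟨C, τ, hC, hτ, h⟩ := E.decay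
  rw [tendsto_iff_norm_sub_tendsto_zero]
  have h1 : Tendsto (fun x : Euc n => C * ‖x‖ ^ (-τ)) (comap norm atTop) (𝓝 0) := by
    have := ((tendsto_rpow_neg_atTop hτ).const_mul C).comp (tendsto_comap (f := fun x : Euc n => ‖x‖))
    simpa [Function.comp_def] using this
  refine squeeze_zero' (Eventually.of_forall fun _ => norm_nonneg _) ?_ h1
  filter_upwards [tendsto_comap.eventually (eventually_gt_atTop E.r₀)] with x hx
  exact h x hx i j

theorem AFEnd.exists_isNearEuclidean {n : ℕ} (E : AFEnd n) {δ : ℝ} (hδ : 0 < δ) :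
    ∃ ρ, ∀ x, ρ < ‖x‖ → IsNearEuclidean (E.coeff x) δ := by
  have h1 : Tendsto E.coeff (comap norm atTop) (𝓝 1) :=
    tendsto_pi_nhds.2 fun i => tendsto_pi_nhds.2 fun j => E.tendsto_coeff i j
  have h2 : Tendsto (fun x => Real.sqrt (E.coeff x).det) (comap norm atTop) (𝓝 1) := by
    have : Continuous fun a : Matrix (Fin n) (Fin n) ℝ => Real.sqrt a.det :=
      Real.continuous_sqrt.comp (Continuous.matrix_det continuous_id)
    have := (this.tendsto 1).comp h1
    simpa [Function.comp_def] using this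
  -- Chosen so that `1 - ε n ≥ (1 + δ)^(-2)`, which bounds the quadratic form from below; `n + 1`
  -- avoids dividing by zero.
  set ε : ℝ := (1 - ((1 + δ) ^ 2)⁻¹) / (n + 1) with hε
  have hlt : ((1 + δ) ^ 2)⁻¹ < 1 := inv_lt_one_of_one_lt₀ (by nlinarith)
  have hε0 : 0 < ε := div_pos (by linarith) (by positivity)
  have hεn : ε * n ≤ 1 - ((1 + δ) ^ 2)⁻¹ := by
    rw [hε, div_mul_eq_mul_div, div_le_iff₀ (by positivity)]
    nlinarith
  have h3 : ∀ᶠ x in comap (norm : Euc n → ℝ) atTop, ∀ i j,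
      |E.coeff x i j - (1 : Matrix (Fin n) (Fin n) ℝ) i j| ≤ ε :=
    eventually_all.2 fun i => eventually_all.2 fun j =>
      ((E.tendsto_coeff i j).eventually (Metric.closedBall_mem_nhds _ hε0)).mono fun x hx => hx
  have h4 : ∀ᶠ x in comap (norm : Euc n → ℝ) atTop, |Real.sqrt (E.coeff x).det - 1| ≤ δ :=
    (h2.eventually (Metric.closedBall_mem_nhds _ hδ)).mono fun x hx => hx
  obtain ⟨ρ, hρ⟩ := eventually_atTop.1 (eventually_comap.1 (h3.and h4))
  refine ⟨ρ, fun x hx => ?_⟩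
  obtain ⟨h5, h6⟩ := hρ ‖x‖ hx.le x rfl
  rw [abs_le] at h6
  refine ⟨by linarith, by linarith, fun w => ?_⟩
  have h7 := (abs_le.1 (abs_quadratic_sub_norm_sq_le h5 w)).1
  have h8 : ((1 + δ) ^ 2)⁻¹ * ‖w‖ ^ 2 ≤ ∑ i, ∑ j, E.coeff x i j * w i * w j := by
    nlinarith [sq_nonneg ‖w‖]
  calc ‖w‖ ^ 2 = (1 + δ) ^ 2 * (((1 + δ) ^ 2)⁻¹ * ‖w‖ ^ 2) := by field_simp
    _ ≤ _ := by gcongr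

/-- The radial map that lengthens each vector by `ρ` is continuous on the punctured space, which is
connected from dimension two on. -/
theorem isPreconnected_norm_gt {n : ℕ} (hn : 2 ≤ n) (ρ : ℝ) (hρ : 0 ≤ ρ) :
    IsPreconnected {x : Euc n | ρ < ‖x‖} := by
  have h1 : IsPreconnected ({0}ᶜ : Set (Euc n)) := by
    refine (isConnected_compl_singleton_of_one_lt_rank ?_ 0).isPreconnected
    rw [← Module.finrank_eq_rank, finrank_euclideanSpace, Fintype.card_fin]
    exact_mod_cast hn
  have h2 : {x : Euc n | ρ < ‖x‖} = (fun x => ((‖x‖ + ρ) / ‖x‖) • x) '' {0}ᶜ := by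
    ext y
    constructor
    · intro (hy : ρ < ‖y‖)
      have h0 : 0 < ‖y‖ := hρ.trans_lt hy
      have h3 : ‖((‖y‖ - ρ) / ‖y‖) • y‖ = ‖y‖ - ρ := by
        rw [norm_smul, Real.norm_of_nonneg (div_nonneg (by linarith) h0.le)]
        field_simp
      have hpos : 0 < ‖y‖ - ρ := by linarith
      refine ⟨((‖y‖ - ρ) / ‖y‖) • y, ?_, ?_⟩
      · rw [mem_compl_singleton_iff, ← norm_pos_iff, h3]
        exact hpos
      · simp only [h3, smul_smul]
        rw [show (‖y‖ - ρ + ρ) / (‖y‖ - ρ) * ((‖y‖ - ρ) / ‖y‖) = 1 by field_simp; ring, one_smul]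
    · rintro ⟨x, hx, rfl⟩
      have h0 : 0 < ‖x‖ := norm_pos_iff.2 hx
      simp only [mem_ofPred_eq]
      rw [norm_smul, Real.norm_of_nonneg (by positivity), div_mul_cancel₀ _ h0.ne']
      linarith
  rw [h2]
  refine h1.image _ fun x hx => ContinuousAt.continuousWithinAt ?_
  have h0 : ‖x‖ ≠ 0 := norm_ne_zero_iff.2 hx
  fun_prop (disch := assumption)

end IsoMass

end

/-! ### Separating the core from infinity, and extending functions over the core. -/

noncomputable section

namespace IsoMass

theorem IsNearEuclidean.norm_le {n : ℕ} {a : Matrix (Fin n) (Fin n) ℝ} {δ : ℝ}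
    (h : IsNearEuclidean a δ) (hδ : 0 ≤ δ) {w : Euc n} (hw : ∑ i, ∑ j, a i j * w i * w j ≤ 1) :
    ‖w‖ ≤ 1 + δ := by
  refine abs_le_of_sq_le_sq' ?_ (by linarith) |>.2
  exact (h.norm_sq_le w).trans (by nlinarith [sq_nonneg (1 + δ)])

variable {n : ℕ} {H : Type*} [TopologicalSpace H] {I : ModelWithCorners ℝ (Euc n) H}
  {M : Type*} [TopologicalSpace M] [ChartedSpace H M] [IsManifold I ∞ M]
  {g : C0Metric I M} {E : AFEnd n} (F : Filling E g)

namespace Filling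

/-- The core has a neighborhood in which the coordinate radius is at most `ρ`. -/
def Encloses (ρ : ℝ) : Prop :=
  ∃ N, IsOpen N ∧ F.core ⊆ N ∧ ∀ p ∈ N, p ∉ F.core → ‖F.chart p‖ ≤ ρ

theorem isOpen_inter_preimage {U : Set (Euc n)} (hU : IsOpen U) :
    IsOpen {p | p ∉ F.core ∧ F.chart p ∈ U} := by
  have := F.chart.isOpen_inter_preimage hU
  rwa [F.source_eq] at this

section Volume

variable [MeasurableSpace M] [BorelSpace M] [SecondCountableTopology M]

theorem le_riemVolume_preimage {U : Set (Euc n)} (hU : IsOpen U) {δ : ℝ}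
    (hR : ∀ x ∈ U, F.R < ‖x‖) (hE : ∀ x ∈ U, IsNearEuclidean (E.coeff x) δ) :
    ENNReal.ofReal (1 - δ) * volume U ≤ riemVolume g {p | p ∉ F.core ∧ F.chart p ∈ U} := by
  rw [F.riemVolume_apply (F.isOpen_inter_preimage hU).measurableSet
    (disjoint_left.2 fun p hp => hp.1)]
  have h : F.chart.symm ⁻¹' {p | p ∉ F.core ∧ F.chart p ∈ U} ∩ F.chart.target = U := by
    ext x
    constructor
    · rintro ⟨⟨_, hx⟩, hxt⟩
      rwa [F.chart.right_inv hxt] at hx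
    · intro hx
      refine ⟨⟨F.symm_notMem_core (hR x hx), ?_⟩, F.mem_target.2 (hR x hx)⟩
      rwa [F.chart_symm (hR x hx)]
  rw [h, ← setLIntegral_const]
  exact setLIntegral_mono' hU.measurableSet fun x hx =>
    ENNReal.ofReal_le_ofReal (hE x hx).le_sqrt_det

theorem riemVolume_exterior (hn : 2 ≤ n) (ρ : ℝ) :
    riemVolume g {p | p ∉ F.core ∧ ρ < ‖F.chart p‖} = ⊤ := by
  obtain ⟨ρ₁, h1⟩ := E.exists_isNearEuclidean (δ := 1 / 2) (by norm_num)
  set r := max ρ (max F.R ρ₁)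
  have hopen : IsOpen {x : Euc n | r < ‖x‖} := isOpen_lt continuous_const continuous_norm
  have h2 := F.le_riemVolume_preimage (δ := 1 / 2) hopen
    (fun x hx => (le_max_left _ _).trans (le_max_right _ _) |>.trans_lt hx)
    (fun x hx => h1 x ((le_max_right _ _).trans (le_max_right _ _) |>.trans_lt hx))
  have : Nontrivial (Euc n) := by
    have : Nonempty (Fin n) := ⟨⟨0, by omega⟩⟩
    infer_instance
  have h3 : volume {x : Euc n | r < ‖x‖} = ⊤ := by
    have h4 : {x : Euc n | r < ‖x‖} = (Metric.closedBall 0 r)ᶜ := by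
      ext x; simp
    rw [h4, measure_compl Metric.isClosed_closedBall.measurableSet measure_closedBall_lt_top.ne,
      measure_univ_of_isAddLeftInvariant]
    exact ENNReal.top_sub measure_closedBall_lt_top.ne
  rw [h3, ENNReal.mul_top (by simp; norm_num)] at h2
  refine top_le_iff.1 (h2.trans (measure_mono fun p hp => ⟨hp.1, ?_⟩))
  exact (le_max_left _ _).trans_lt hp.2

/-- The frontier of a compact neighborhood `N` of the core has bounded coordinate radius. Beyond
that radius the connected exterior misses the frontier, so it lies in the interior of `N` or outside
`N`. The former is impossible: the exterior has infinite volume, a compact set finite volume. -/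
theorem exists_encloses [T2Space M] (hn : 2 ≤ n) : ∃ ρ, F.Encloses ρ := by
  have : LocallyCompactSpace M := Manifold.locallyCompact_of_finiteDimensional I
  obtain ⟨N, hNc, hN⟩ := exists_compact_superset F.isCompact_core
  have hfr : IsCompact (frontier N) := hNc.of_isClosed_subset isClosed_frontier
    hNc.isClosed.frontier_subset
  have hfrc : frontier N ⊆ F.chart.source := fun p hp => F.mem_source.2 fun hpc =>
    hp.2 (hN hpc)
  obtain ⟨ρ, hρ⟩ := (hfr.image_of_continuousOn
    (F.chart.continuousOn.mono hfrc)).isBounded.exists_norm_le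
  set r := max ρ F.R
  have hr : F.R ≤ r := le_max_right _ _
  refine ⟨r, interior N, isOpen_interior, hN, fun p hpN hpc => ?_⟩
  by_contra hlt
  rw [not_le] at hlt
  have hconn : IsPreconnected (F.chart.symm '' {x | r < ‖x‖}) :=
    (isPreconnected_norm_gt hn r (F.R_pos.le.trans hr)).image _
      (F.chart.continuousOn_symm.mono fun x hx => F.mem_target.2 (hr.trans_lt hx))
  have hsub : F.chart.symm '' {x | r < ‖x‖} ⊆ interior N ∪ Nᶜ := by
    rintro _ ⟨x, hx, rfl⟩
    by_contra h
    simp only [mem_union, mem_compl_iff, not_or, not_not] at h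
    have hfx : F.chart.symm x ∈ frontier N := ⟨subset_closure h.2, h.1⟩
    have := hρ _ (mem_image_of_mem _ hfx)
    rw [F.chart_symm (hr.trans_lt hx)] at this
    exact absurd hx (not_lt.2 (this.trans (le_max_left _ _)))
  have hpm : p ∈ F.chart.symm '' {x | r < ‖x‖} := ⟨F.chart p, hlt, F.symm_chart hpc⟩
  have hint : F.chart.symm '' {x | r < ‖x‖} ⊆ interior N :=
    hconn.subset_left_of_subset_union isOpen_interior hNc.isClosed.isOpen_compl
      (disjoint_left.2 fun q hq hq' => hq' (interior_subset hq)) hsub ⟨p, hpm, hpN⟩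
  have h1 := F.riemVolume_exterior hn r
  have h2 : {p | p ∉ F.core ∧ r < ‖F.chart p‖} ⊆ N := fun q hq =>
    interior_subset (hint ⟨F.chart q, hq.2, F.symm_chart hq.1⟩)
  exact absurd ((measure_mono h2).trans_lt hNc.measure_lt_top) (by rw [h1]; exact lt_irrefl _)

end Volume

variable {F}

theorem Encloses.mono {ρ r : ℝ} (h : F.Encloses ρ) (hr : ρ ≤ r) : F.Encloses r := by
  obtain ⟨N, h1, h2, h3⟩ := h
  exact ⟨N, h1, h2, fun p hp hpc => (h3 p hp hpc).trans hr⟩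

variable (F)

open Classical in
/-- The function on `M` that is `G` in the coordinates of the end and `1` on the core. -/
def extend (G : Euc n → ℝ) (p : M) : ℝ := if p ∈ F.core then 1 else G (F.chart p)

theorem extend_of_mem {G : Euc n → ℝ} {p : M} (hp : p ∈ F.core) : F.extend G p = 1 := if_pos hp

theorem extend_of_notMem {G : Euc n → ℝ} {p : M} (hp : p ∉ F.core) :
    F.extend G p = G (F.chart p) := if_neg hp

variable {F} {G : Euc n → ℝ} {ρ : ℝ}

theorem Encloses.extend_eventuallyEq_one (h : F.Encloses ρ) (hG : ∀ x, ‖x‖ ≤ ρ → G x = 1)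
    {p : M} (hp : p ∈ F.core) : F.extend G =ᶠ[𝓝 p] fun _ => 1 := by
  obtain ⟨N, h1, h2, h3⟩ := h
  filter_upwards [h1.mem_nhds (h2 hp)] with q hq
  by_cases hqc : q ∈ F.core
  · exact F.extend_of_mem hqc
  · rw [F.extend_of_notMem hqc, hG _ (h3 q hq hqc)]

variable (F) in
theorem extend_eventuallyEq (G : Euc n → ℝ) {p : M} (hp : p ∉ F.core) :
    F.extend G =ᶠ[𝓝 p] G ∘ F.chart := by
  filter_upwards [F.chart.open_source.mem_nhds (F.mem_source.2 hp)] with q hq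
  exact F.extend_of_notMem (F.mem_source.1 hq)

/-- `Encloses` is what gives regularity at the edge of the core: near each core point the extension
is constantly 1. -/
theorem Encloses.contMDiff_extend (h : F.Encloses ρ) (hG : ∀ x, ‖x‖ ≤ ρ → G x = 1)
    (hGd : ContDiff ℝ 1 G) : ContMDiff I 𝓘(ℝ, ℝ) 1 (F.extend G) := by
  intro p
  by_cases hp : p ∈ F.core
  · exact contMDiffAt_const.congr_of_eventuallyEq (h.extend_eventuallyEq_one hG hp)
  · refine ContMDiffAt.congr_of_eventuallyEq ?_ (F.extend_eventuallyEq G hp)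
    have h1 := (F.contMDiffOn_chart p (F.mem_source.2 hp)).contMDiffAt
      (F.chart.open_source.mem_nhds (F.mem_source.2 hp))
    exact hGd.contMDiff.contMDiffAt.comp p (h1.of_le (by simp))

theorem Encloses.gradNorm_extend_of_mem (h : F.Encloses ρ) (hG : ∀ x, ‖x‖ ≤ ρ → G x = 1)
    {p : M} (hp : p ∈ F.core) : gradNorm g (F.extend G) p = 0 := by
  have h1 : mfderiv I 𝓘(ℝ, ℝ) (F.extend G) p = 0 :=
    ((hasMFDerivAt_const (1 : ℝ) p).congr_of_eventuallyEq
      (h.extend_eventuallyEq_one hG hp)).mfderiv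
  rw [gradNorm, h1]
  refine le_antisymm (iSup₂_le fun v _ => ?_) bot_le
  exact (ENNReal.ofReal_eq_zero.2 (abs_zero (α := ℝ)).le).le

variable (F) in
theorem gradNorm_extend_le (hGd : ContDiff ℝ 1 G) {x : Euc n} (hx : F.R < ‖x‖) {K : ℝ}
    (hK : ∀ w : Euc n, ∑ i, ∑ j, E.coeff x i j * w i * w j ≤ 1 → |fderiv ℝ G x w| ≤ K) :
    gradNorm g (F.extend G) (F.chart.symm x) ≤ ENNReal.ofReal K := by
  have hp := F.symm_notMem_core hx
  have h1 : MDifferentiableAt 𝓘(ℝ, Euc n) 𝓘(ℝ, ℝ) G (F.chart (F.chart.symm x)) :=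
    (hGd.differentiable (by norm_num) _).mdifferentiableAt
  have h2 := (h1.hasMFDerivAt.comp _ (F.mdifferentiableAt_chart hp).hasMFDerivAt).congr_of_eventuallyEq
    (F.extend_eventuallyEq G hp)
  refine iSup₂_le fun v hv => ENNReal.ofReal_le_ofReal ?_
  rw [h2.mfderiv]
  set w : Euc n := mfderiv I 𝓘(ℝ, Euc n) F.chart (F.chart.symm x) v with hw
  have h3 : mfderiv 𝓘(ℝ, Euc n) I F.chart.symm x w = v := F.mfderiv_symm_mfderiv_chart hx v
  have h4 := F.inner_mfderiv_symm hx w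
  rw [h3] at h4
  have h5 := hK w (h4.symm.trans_le hv)
  have h6 : mfderiv 𝓘(ℝ, Euc n) 𝓘(ℝ, ℝ) G (F.chart (F.chart.symm x)) = fderiv ℝ G x := by
    rw [F.chart_symm hx, mfderiv_eq_fderiv]
  refine le_trans (le_of_eq ?_) h5
  rw [← h6]
  rfl

end Filling

end IsoMass

end

/-! ### Perimeter and volume of a filled sphere together with a distant ball. -/

noncomputable section

namespace IsoMass

theorem fderiv_ramp_eq_zero_of_norm_lt {n : ℕ} (c : Euc n) {a b : ℝ} (ha : 0 ≤ a) (hab : a < b)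
    {x : Euc n} (hx : ‖x - c‖ < a) : fderiv ℝ (ramp c a b) x = 0 := by
  have h : ramp c a b =ᶠ[𝓝 x] fun _ => 1 := by
    have : ∀ᶠ y in 𝓝 x, ‖y - c‖ < a :=
      (continuous_id.sub continuous_const).norm.continuousAt.eventually_lt continuousAt_const hx
    filter_upwards [this] with y hy using ramp_eq_one c ha hab hy.le
  rw [h.fderiv_eq, fderiv_const_apply]

theorem fderiv_ramp_eq_zero_of_lt_norm {n : ℕ} (c : Euc n) {a b : ℝ} (ha : 0 ≤ a) (hab : a < b)
    {x : Euc n} (hx : b < ‖x - c‖) : fderiv ℝ (ramp c a b) x = 0 := by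
  have h : ramp c a b =ᶠ[𝓝 x] fun _ => 0 := by
    have : ∀ᶠ y in 𝓝 x, b < ‖y - c‖ :=
      continuousAt_const.eventually_lt (continuous_id.sub continuous_const).norm.continuousAt hx
    filter_upwards [this] with y hy using ramp_eq_zero c ha hab hy.le
  rw [h.fderiv_eq, fderiv_const_apply]

variable {n : ℕ} {H : Type*} [TopologicalSpace H] {I : ModelWithCorners ℝ (Euc n) H}
  {M : Type*} [TopologicalSpace M] [ChartedSpace H M] [IsManifold I ∞ M]
  {g : C0Metric I M} {E : AFEnd n} (F : Filling E g)

namespace Filling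

/-- The region inside of the coordinate sphere of radius `s`, together with the coordinate ball of
radius `ρ` about `c`. -/
def region (s : ℝ) (c : Euc n) (ρ : ℝ) : Set M :=
  {p | p ∈ F.core ∨ ‖F.chart p‖ < s ∨ ‖F.chart p - c‖ < ρ}

variable {F} in
theorem Encloses.isOpen_region {ρ₀ s : ℝ} (h : F.Encloses ρ₀) (hs : ρ₀ < s) (c : Euc n) (ρ : ℝ) :
    IsOpen (F.region s c ρ) := by
  obtain ⟨N, h1, h2, h3⟩ := h
  have h4 : F.region s c ρ =
      N ∪ {p | p ∉ F.core ∧ F.chart p ∈ {x | ‖x‖ < s ∨ ‖x - c‖ < ρ}} := by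
    ext p
    by_cases hp : p ∈ F.core
    · exact ⟨fun _ => Or.inl (h2 hp), fun _ => Or.inl hp⟩
    · constructor
      · rintro (hpc | hpc)
        · exact absurd hpc hp
        · exact Or.inr ⟨hp, hpc⟩
      · rintro (hpN | hpc)
        · exact Or.inr (Or.inl ((h3 p hpN hp).trans_lt hs))
        · exact Or.inr hpc.2
  rw [h4]
  refine h1.union (F.isOpen_inter_preimage (IsOpen.union ?_ ?_))
  · exact isOpen_lt continuous_norm continuous_const
  · exact isOpen_lt (continuous_id.sub continuous_const).norm continuous_const

theorem region_subset {s : ℝ} {c : Euc n} {ρ : ℝ} {r : ℝ} (hs : s ≤ r) (hρ : ‖c‖ + ρ ≤ r) :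
    F.region s c ρ ⊆ F.core ∪ {p | p ∉ F.core ∧ ‖F.chart p‖ < r} := by
  rintro p hp
  by_cases hpc : p ∈ F.core
  · exact Or.inl hpc
  refine Or.inr ⟨hpc, ?_⟩
  rcases hp with hp | hp | hp
  · exact absurd hp hpc
  · exact hp.trans_le hs
  · have := norm_le_norm_add_norm_sub' (F.chart p) c
    linarith

theorem isCompact_closure_region [T2Space M] (s : ℝ) (c : Euc n) (ρ : ℝ) :
    IsCompact (closure (F.region s c ρ)) := by
  refine (F.isCompact_enclosed (max s (‖c‖ + ρ))).closure_of_subset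
    ((F.region_subset (le_max_left _ _) (le_max_right _ _)).trans ?_)
  exact union_subset_union_right _ fun p hp => ⟨hp.1, hp.2.le⟩

variable [MeasurableSpace M] [BorelSpace M] [SecondCountableTopology M] [T2Space M]

-- Each transition layer contributes one factor `1 + ε` from the dual norm and one from the volume
-- density. At the inner sphere `ε = 1` is good enough: the resulting 4 is harmless because `s` is
-- fixed before `ρ`.
variable {F} in
theorem Encloses.lintegral_gradNorm_le (hn : 3 ≤ n) {ρ₀ a s a' ρ δ : ℝ} {c : Euc n}
    (h : F.Encloses ρ₀) (h0 : 0 < ρ₀) (h1 : ∀ x, ρ₀ < ‖x‖ → IsNearEuclidean (E.coeff x) 1)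
    (ha : ρ₀ < a) (has : a < s) (ha' : 0 ≤ a') (haρ : a' < ρ) (hδ : 0 ≤ δ)
    (h2 : ∀ x, ‖x - c‖ ≤ ρ → IsNearEuclidean (E.coeff x) δ) (hc : ρ + s < ‖c‖) :
    ∫⁻ p, gradNorm g (F.extend fun x => ramp 0 a s x + ramp c a' ρ x) p ∂(riemVolume g) ≤
      ENNReal.ofReal (4 * (sphereArea n * s ^ (n - 1)) +
        (1 + δ) ^ 2 * (sphereArea n * ρ ^ (n - 1))) := by
  set f₀ : Euc n → ℝ := ramp 0 a s with hf₀
  set f₁ : Euc n → ℝ := ramp c a' ρ with hf₁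
  have ha0 : 0 ≤ a := (h0.trans ha).le
  have hd₀ : ContDiff ℝ 1 f₀ := contDiff_ramp _ _ _
  have hd₁ : ContDiff ℝ 1 f₁ := contDiff_ramp _ _ _
  have hω : 0 ≤ sphereArea n := mul_nonneg n.cast_nonneg ENNReal.toReal_nonneg
  have hG : ∀ x, ‖x‖ ≤ ρ₀ → f₀ x + f₁ x = 1 := by
    intro x hx
    rw [hf₀, hf₁, ramp_eq_one 0 ha0 has (by rw [sub_zero]; linarith), ramp_eq_zero c ha' haρ, add_zero]
    have := norm_le_norm_add_norm_sub x c
    linarith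
  have near₀ {x : Euc n} (hx : fderiv ℝ f₀ x ≠ 0) : IsNearEuclidean (E.coeff x) 1 := by
    refine h1 x (ha.trans_le ?_)
    by_contra hlt
    exact hx (fderiv_ramp_eq_zero_of_norm_lt 0 ha0 has (by rw [sub_zero]; linarith))
  have near₁ {x : Euc n} (hx : fderiv ℝ f₁ x ≠ 0) : IsNearEuclidean (E.coeff x) δ := by
    refine h2 x ?_
    by_contra hlt
    exact hx (fderiv_ramp_eq_zero_of_lt_norm c ha' haρ (not_le.1 hlt))
  have bound {f : Euc n → ℝ} {ε : ℝ} (hε : 0 ≤ ε) {x : Euc n}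
      (hf : fderiv ℝ f x ≠ 0 → IsNearEuclidean (E.coeff x) ε) {w : Euc n}
      (hw : ∑ i, ∑ j, E.coeff x i j * w i * w j ≤ 1) :
      |fderiv ℝ f x w| ≤ (1 + ε) * ‖fderiv ℝ f x‖ := by
    by_cases hz : fderiv ℝ f x = 0
    · simp [hz]
    · rw [mul_comm]
      exact ((fderiv ℝ f x).le_opNorm w).trans
        (mul_le_mul_of_nonneg_left ((hf hz).norm_le hε hw) (norm_nonneg _))
  have dens {f : Euc n → ℝ} {ε : ℝ} (hε : 0 ≤ ε) {x : Euc n}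
      (hf : fderiv ℝ f x ≠ 0 → IsNearEuclidean (E.coeff x) ε) :
      E.density x * (ENNReal.ofReal (1 + ε) * ‖fderiv ℝ f x‖ₑ) ≤
        ENNReal.ofReal ((1 + ε) ^ 2) * ‖fderiv ℝ f x‖ₑ := by
    by_cases hz : fderiv ℝ f x = 0
    · have : ‖fderiv ℝ f x‖ₑ = 0 := by rw [hz, ← ofReal_norm, norm_zero, ENNReal.ofReal_zero]
      rw [this, mul_zero, mul_zero, mul_zero]
    · rw [← mul_assoc, sq, ENNReal.ofReal_mul (by linarith)]
      gcongr
      exact ENNReal.ofReal_le_ofReal (hf hz).sqrt_det_le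
  have hm₀ : Measurable fun x => ‖fderiv ℝ f₀ x‖ₑ :=
    (hd₀.continuous_fderiv (by norm_num)).enorm.measurable
  have hm₁ : Measurable fun x => ‖fderiv ℝ f₁ x‖ₑ :=
    (hd₁.continuous_fderiv (by norm_num)).enorm.measurable
  have key := F.lintegral_le (f := gradNorm g (F.extend fun x => f₀ x + f₁ x))
    (φ := fun x => ENNReal.ofReal (1 + 1) * ‖fderiv ℝ f₀ x‖ₑ +
      ENNReal.ofReal (1 + δ) * ‖fderiv ℝ f₁ x‖ₑ) (by fun_prop)
    (fun p hp => h.gradNorm_extend_of_mem hG hp) (fun x hx => by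
      refine (F.gradNorm_extend_le (hd₀.add hd₁) hx
        (K := (1 + 1) * ‖fderiv ℝ f₀ x‖ + (1 + δ) * ‖fderiv ℝ f₁ x‖) fun w hw => ?_).trans
        (le_of_eq ?_)
      · rw [fderiv_fun_add (hd₀.differentiable (by norm_num) x)
          (hd₁.differentiable (by norm_num) x), add_apply]
        exact (abs_add_le _ _).trans (add_le_add (bound zero_le_one near₀ hw) (bound hδ near₁ hw))
      · rw [ENNReal.ofReal_add (by positivity) (by positivity), ENNReal.ofReal_mul (by norm_num),
          ENNReal.ofReal_mul (by positivity), ofReal_norm, ofReal_norm])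
  refine key.trans ?_
  calc ∫⁻ x in F.chart.target, E.density x * (ENNReal.ofReal (1 + 1) * ‖fderiv ℝ f₀ x‖ₑ +
        ENNReal.ofReal (1 + δ) * ‖fderiv ℝ f₁ x‖ₑ)
      ≤ ∫⁻ x in F.chart.target, (ENNReal.ofReal ((1 + 1) ^ 2) * ‖fderiv ℝ f₀ x‖ₑ +
        ENNReal.ofReal ((1 + δ) ^ 2) * ‖fderiv ℝ f₁ x‖ₑ) := by
        refine lintegral_mono fun x => ?_
        rw [mul_add]
        exact add_le_add (dens zero_le_one near₀) (dens hδ near₁)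
    _ ≤ ∫⁻ x, (ENNReal.ofReal ((1 + 1) ^ 2) * ‖fderiv ℝ f₀ x‖ₑ +
        ENNReal.ofReal ((1 + δ) ^ 2) * ‖fderiv ℝ f₁ x‖ₑ) := setLIntegral_le_lintegral _ _
    _ = ENNReal.ofReal ((1 + 1) ^ 2) * (∫⁻ x, ‖fderiv ℝ f₀ x‖ₑ) +
        ENNReal.ofReal ((1 + δ) ^ 2) * (∫⁻ x, ‖fderiv ℝ f₁ x‖ₑ) := by
        rw [lintegral_add_left (by fun_prop), lintegral_const_mul _ hm₀, lintegral_const_mul _ hm₁]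
    _ ≤ ENNReal.ofReal ((1 + 1) ^ 2) * ENNReal.ofReal (sphereArea n * s ^ (n - 1)) +
        ENNReal.ofReal ((1 + δ) ^ 2) * ENNReal.ofReal (sphereArea n * ρ ^ (n - 1)) := by
        gcongr
        · exact lintegral_fderiv_ramp_le 0 hn ha0 has
        · exact lintegral_fderiv_ramp_le c hn ha' haρ
    _ = _ := by
        have hs : 0 ≤ s := ha0.trans has.le
        have hρ : 0 ≤ ρ := ha'.trans haρ.le
        rw [← ENNReal.ofReal_mul (by positivity), ← ENNReal.ofReal_mul (by positivity),
          ← ENNReal.ofReal_add (by positivity) (by positivity)]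
        norm_num

-- The test functions are sums of two ramps with fixed outer radii `s` and `ρ` and inner radii
-- increasing to them. At each point they eventually equal the indicator, so dominated convergence
-- on compact sets gives the `L¹_loc` limit.
variable {F} in
theorem Encloses.perimeter_region_le (hn : 3 ≤ n) {ρ₀ s ρ δ : ℝ} {c : Euc n}
    (h : F.Encloses ρ₀) (h0 : 0 < ρ₀) (h1 : ∀ x, ρ₀ < ‖x‖ → IsNearEuclidean (E.coeff x) 1)
    (hs : ρ₀ < s) (hρ : 0 < ρ) (hδ : 0 ≤ δ)
    (h2 : ∀ x, ‖x - c‖ ≤ ρ → IsNearEuclidean (E.coeff x) δ) (hc : ρ + s < ‖c‖) :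
    perimeter g (F.region s c ρ) ≤
      ENNReal.ofReal (4 * (sphereArea n * s ^ (n - 1)) +
        (1 + δ) ^ 2 * (sphereArea n * ρ ^ (n - 1))) := by
  let u : ℕ → ℝ := fun k => 1 / ((k : ℝ) + 1)
  have hu0 (k : ℕ) : 0 < u k := by positivity
  have hu1 (k : ℕ) : u k ≤ 1 := by
    rw [div_le_one (by positivity)]
    linarith [k.cast_nonneg (α := ℝ)]
  have hu : Tendsto u atTop (𝓝 0) := tendsto_one_div_add_atTop_nhds_zero_nat
  -- The half keeps `a k` strictly above `ρ₀` even at `k = 0`, where `u` is 1; for the inner radius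
  -- `a'` the value 0 is allowed.
  let a : ℕ → ℝ := fun k => s - (s - ρ₀) / 2 * u k
  let a' : ℕ → ℝ := fun k => ρ - ρ * u k
  have ha (k : ℕ) : ρ₀ < a k := by
    have := mul_le_mul_of_nonneg_left (hu1 k) (by linarith : 0 ≤ (s - ρ₀) / 2)
    simp only [a]; linarith
  have has (k : ℕ) : a k < s := by
    have := mul_pos (by linarith : 0 < (s - ρ₀) / 2) (hu0 k)
    simp only [a]; linarith
  have ha' (k : ℕ) : 0 ≤ a' k := by
    have := mul_le_mul_of_nonneg_left (hu1 k) hρ.le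
    simp only [a']; linarith
  have haρ (k : ℕ) : a' k < ρ := by
    have := mul_pos hρ (hu0 k)
    simp only [a']; linarith
  have hat : Tendsto a atTop (𝓝 s) := by
    simpa using tendsto_const_nhds.sub (hu.const_mul ((s - ρ₀) / 2))
  have hat' : Tendsto a' atTop (𝓝 ρ) := by
    simpa using tendsto_const_nhds.sub (hu.const_mul ρ)
  have ha0 (k : ℕ) : 0 ≤ a k := (h0.trans (ha k)).le
  let G : ℕ → Euc n → ℝ := fun k x => ramp 0 (a k) s x + ramp c (a' k) ρ x
  have hG (k : ℕ) (x : Euc n) (hx : ‖x‖ ≤ ρ₀) : G k x = 1 := by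
    have := ha k
    simp only [G]
    rw [ramp_eq_one 0 (ha0 k) (has k) (by rw [sub_zero]; linarith),
      ramp_eq_zero c (ha' k) (haρ k), add_zero]
    have := norm_le_norm_add_norm_sub x c
    linarith
  have hsmooth (k : ℕ) : ContMDiff I 𝓘(ℝ, ℝ) 1 (F.extend (G k)) :=
    h.contMDiff_extend (hG k) ((contDiff_ramp _ _ _).add (contDiff_ramp _ _ _))
  have hlim (p : M) : ∀ᶠ k in atTop,
      F.extend (G k) p = (F.region s c ρ).indicator (fun _ => (1 : ℝ)) p := by
    by_cases hp : p ∈ F.core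
    · refine Eventually.of_forall fun k => ?_
      rw [F.extend_of_mem hp, indicator_of_mem (show p ∈ F.region s c ρ from Or.inl hp)]
    simp only [F.extend_of_notMem hp, G]
    by_cases hps : ‖F.chart p‖ < s
    · filter_upwards [hat.eventually (lt_mem_nhds hps)] with k hk
      rw [indicator_of_mem (show p ∈ F.region s c ρ from Or.inr (Or.inl hps)),
        ramp_eq_one 0 (ha0 k) (has k) (by rw [sub_zero]; exact hk.le),
        ramp_eq_zero c (ha' k) (haρ k), add_zero]
      have := norm_le_norm_add_norm_sub (F.chart p) c
      linarith
    by_cases hpc : ‖F.chart p - c‖ < ρ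
    · filter_upwards [hat'.eventually (lt_mem_nhds hpc)] with k hk
      rw [indicator_of_mem (show p ∈ F.region s c ρ from Or.inr (Or.inr hpc)),
        ramp_eq_zero 0 (ha0 k) (has k) (by rw [sub_zero]; exact not_lt.1 hps),
        ramp_eq_one c (ha' k) (haρ k) hk.le, zero_add]
    · refine Eventually.of_forall fun k => ?_
      rw [indicator_of_notMem (by simp only [region, mem_ofPred_eq]; tauto),
        ramp_eq_zero 0 (ha0 k) (has k) (by rw [sub_zero]; exact not_lt.1 hps),
        ramp_eq_zero c (ha' k) (haρ k) (not_lt.1 hpc), zero_add]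
  have hind : Measurable ((F.region s c ρ).indicator fun _ => (1 : ℝ)) :=
    measurable_const.indicator (h.isOpen_region hs c ρ).measurableSet
  have hL1 : TendstoIndicatorL1Loc g (fun k => F.extend (G k)) (F.region s c ρ) := by
    intro C hC
    have := tendsto_lintegral_of_dominated_convergence (μ := (riemVolume g).restrict C)
      (F := fun k p => ENNReal.ofReal
        |F.extend (G k) p - (F.region s c ρ).indicator (fun _ => (1 : ℝ)) p|)
      (f := fun _ => 0) (fun _ => ENNReal.ofReal 3)
      (fun k => (((hsmooth k).continuous.measurable.sub hind).abs).ennreal_ofReal)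
      (fun k => Eventually.of_forall fun p => ENNReal.ofReal_le_ofReal ?_)
      (by rw [setLIntegral_const]; exact (ENNReal.mul_lt_top ENNReal.ofReal_lt_top
        hC.measure_lt_top).ne)
      (Eventually.of_forall fun p => tendsto_const_nhds.congr' ((hlim p).mono fun k hk => by
        simp only [hk]; simp))
    · simpa using this
    · have h3 : 0 ≤ F.extend (G k) p ∧ F.extend (G k) p ≤ 2 := by
        by_cases hp : p ∈ F.core
        · rw [F.extend_of_mem hp]; norm_num
        · rw [F.extend_of_notMem hp]
          have e1 := ramp_nonneg 0 (a k) s (F.chart p)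
          have e2 := ramp_nonneg c (a' k) ρ (F.chart p)
          have e3 := ramp_le_one 0 (a k) s (F.chart p)
          have e4 := ramp_le_one c (a' k) ρ (F.chart p)
          simp only [G]
          constructor <;> linarith
      have h4 : 0 ≤ (F.region s c ρ).indicator (fun _ => (1 : ℝ)) p :=
        indicator_nonneg (fun _ _ => zero_le_one) p
      have h5 : (F.region s c ρ).indicator (fun _ => (1 : ℝ)) p ≤ 1 :=
        indicator_le_self' (fun _ _ => zero_le_one) p
      rw [abs_le]
      constructor <;> linarith
  refine (iInf₂_le_of_le (fun k => F.extend (G k)) hsmooth (iInf_le _ hL1)).trans ?_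
  refine (liminf_le_liminf (Eventually.of_forall fun k =>
    h.lintegral_gradNorm_le hn h0 h1 (ha k) (has k) (ha' k) (haρ k) hδ h2 hc)).trans ?_
  rw [liminf_const]

theorem le_riemVolume_region {s ρ δ : ℝ} {c : Euc n} (hρ : 0 < ρ)
    (h2 : ∀ x, ‖x - c‖ ≤ ρ → IsNearEuclidean (E.coeff x) δ) (hR : F.R ≤ s) (hc : ρ + s < ‖c‖)
    (hδ : δ ≤ 1) :
    (1 - δ) * (ρ ^ n * (volume (Metric.ball (0 : Euc n) 1)).toReal) ≤
      (riemVolume g (F.region s c ρ)).toReal := by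
  have h1 := F.le_riemVolume_preimage (U := Metric.ball c ρ) (δ := δ) Metric.isOpen_ball
    (fun x hx => by
      rw [mem_ball_iff_norm] at hx
      have := norm_le_norm_add_norm_sub x c
      linarith)
    (fun x hx => h2 x (mem_ball_iff_norm.1 hx).le)
  have hfin : riemVolume g (F.region s c ρ) < ⊤ :=
    (measure_mono subset_closure).trans_lt (F.isCompact_closure_region s c ρ).measure_lt_top
  have h3 : riemVolume g {p | p ∉ F.core ∧ F.chart p ∈ Metric.ball c ρ} ≤
      riemVolume g (F.region s c ρ) :=
    measure_mono fun p hp => Or.inr (Or.inr (mem_ball_iff_norm.1 hp.2))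
  have h4 := ENNReal.toReal_mono hfin.ne (h1.trans h3)
  rw [Measure.addHaar_ball_of_pos volume c hρ] at h4
  simpa [ENNReal.toReal_mul, ENNReal.toReal_ofReal (sub_nonneg.2 hδ), hρ.le] using h4

end Filling

end IsoMass

end

/-! ### The mass as a function of volume and perimeter, and the exhaustion. -/

noncomputable section

namespace IsoMass

/-- The quasilocal isoperimetric mass as a function of volume and perimeter. -/
def massFun (n : ℕ) (V P : ℝ) : ℝ :=
  2 / (sphereArea n ^ (((n : ℝ) - 3) / ((n : ℝ) - 1)) * P ^ (2 / ((n : ℝ) - 1))) *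
    (V - P ^ ((n : ℝ) / ((n : ℝ) - 1)) / (n * sphereArea n ^ (1 / ((n : ℝ) - 1))))

theorem sphereArea_pos {n : ℕ} (hn : 3 ≤ n) : 0 < sphereArea n := by
  refine mul_pos (by positivity) (ENNReal.toReal_pos ?_ measure_ball_lt_top.ne)
  exact (Metric.measure_ball_pos volume 0 one_pos).ne'

theorem massFun_zero {n : ℕ} (hn : 3 ≤ n) (V : ℝ) : massFun n V 0 = 0 := by
  have h3 : (3 : ℝ) ≤ n := by exact_mod_cast hn
  have : 2 / ((n : ℝ) - 1) ≠ 0 := (div_pos two_pos (by linarith)).ne'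
  simp [massFun, Real.zero_rpow this]

/-- Writing the perimeter as the area of a round sphere of radius `r` makes all fractional powers of
`sphereArea n` cancel. -/
theorem massFun_sphere {n : ℕ} (hn : 3 ≤ n) (V : ℝ) {r : ℝ} (hr : 0 < r) :
    massFun n V (sphereArea n * r ^ (n - 1)) =
      2 / (sphereArea n * r ^ 2) * (V - sphereArea n / n * r ^ n) := by
  have hω := sphereArea_pos hn
  set α := sphereArea n
  have h3 : (3 : ℝ) ≤ n := by exact_mod_cast hn
  have h1 : (n : ℝ) - 1 ≠ 0 := by linarith
  have hcast : ((n - 1 : ℕ) : ℝ) = (n : ℝ) - 1 := by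
    rw [Nat.cast_sub (by omega)]; simp
  have hpow (t : ℝ) : (α * r ^ (n - 1)) ^ (t / ((n : ℝ) - 1)) =
      α ^ (t / ((n : ℝ) - 1)) * r ^ t := by
    rw [Real.mul_rpow hω.le (by positivity), ← Real.rpow_natCast r (n - 1), ← Real.rpow_mul hr.le,
      hcast, mul_div_cancel₀ _ h1]
  have e1 : α ^ (((n : ℝ) - 3) / ((n : ℝ) - 1)) * α ^ (2 / ((n : ℝ) - 1)) = α := by
    rw [← Real.rpow_add hω, ← add_div, show (n : ℝ) - 3 + 2 = n - 1 by ring, div_self h1,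
      Real.rpow_one]
  have e2 : α ^ ((n : ℝ) / ((n : ℝ) - 1)) = α * α ^ (1 / ((n : ℝ) - 1)) := by
    have h2 : 0 < (n : ℝ) - 1 := by linarith
    conv_rhs => rw [← Real.rpow_one_add' hω.le (by positivity)]
    congr 1
    field_simp
    ring
  have e3 : 0 < α ^ (1 / ((n : ℝ) - 1)) := Real.rpow_pos_of_pos hω _
  rw [massFun, hpow 2, hpow n, ← mul_assoc, e1, e2, Real.rpow_natCast,
    Real.rpow_ofNat]
  congr 2
  change α * α ^ (1 / ((n : ℝ) - 1)) * r ^ n / (n * α ^ (1 / ((n : ℝ) - 1))) = _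
  field_simp

theorem exists_radius_pow {n : ℕ} (hn : 3 ≤ n) {P : ℝ} (hP : 0 ≤ P) :
    sphereArea n * ((P / sphereArea n) ^ (1 / ((n - 1 : ℕ) : ℝ))) ^ (n - 1) = P := by
  have hω := sphereArea_pos hn
  rw [one_div, Real.rpow_inv_natCast_pow (by positivity) (by omega)]
  field_simp

/-- The difference is `r c + ρ (r - ρ) ρ^(n-2)`, and `(r - ρ) ρ^(n-2) ≤ c`. The growth is only
linear in `r`, so it loses against the factor `r ^ 2` in the denominator of the mass. -/
theorem pow_sub_pow_le {n : ℕ} (hn : 3 ≤ n) {ρ r c : ℝ} (hρ : 0 < ρ) (hr : ρ ≤ r)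
    (h : r ^ (n - 1) = ρ ^ (n - 1) + c) : r ^ n - ρ ^ n ≤ 2 * c * r := by
  obtain ⟨m, rfl⟩ : ∃ m, n = m + 2 := ⟨n - 2, by omega⟩
  simp only [show m + 2 - 1 = m + 1 by omega] at h
  have h0 : ρ ^ m ≤ r ^ m := pow_le_pow_left₀ hρ.le hr m
  have hm : 0 < ρ ^ m := by positivity
  have h1 : (r - ρ) * ρ ^ m ≤ c := by
    have : r ^ m * r = ρ ^ m * ρ + c := by rw [← pow_succ, ← pow_succ]; exact h
    nlinarith
  have hc : 0 ≤ c := le_trans (mul_nonneg (by linarith) hm.le) h1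
  have h2 : r ^ (m + 2) - ρ ^ (m + 2) = r * c + ρ * ((r - ρ) * ρ ^ m) := by
    rw [show m + 2 = (m + 1) + 1 by omega, pow_succ r (m + 1), h]
    ring
  rw [h2]
  nlinarith

/-- At positive volume and perimeter the mass increases with volume and decreases with perimeter, so
one-sided bounds on both suffice. -/
theorem lt_massFun_of_le {n : ℕ} (hn : 3 ≤ n) {V₀ V P ε r₁ : ℝ} (hε : 0 < ε) (hV₀ : 0 < V₀)
    (hV : V₀ ≤ V) (hP : 0 ≤ P) (hr₁ : 0 < r₁) (hPr : P ≤ sphereArea n * r₁ ^ (n - 1))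
    (h : -ε < 2 / (sphereArea n * r₁ ^ 2) * (V₀ - sphereArea n / n * r₁ ^ n)) :
    -ε < massFun n V P := by
  have hω := sphereArea_pos hn
  rcases hP.eq_or_lt with rfl | hP
  -- Perimeter zero is not excluded; division by zero then makes the mass 0.
  · rw [massFun_zero hn]; linarith
  set r := (P / sphereArea n) ^ (1 / ((n - 1 : ℕ) : ℝ)) with hr
  have hPeq : sphereArea n * r ^ (n - 1) = P := exists_radius_pow hn hP.le
  have hr0 : 0 < r := Real.rpow_pos_of_pos (by positivity) _
  rw [← hPeq, massFun_sphere hn V hr0]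
  have hle : r ≤ r₁ := by
    rw [← hPeq] at hPr
    exact le_of_pow_le_pow_left₀ (by omega) hr₁.le (le_of_mul_le_mul_left hPr hω)
  set α := sphereArea n
  obtain ⟨m, rfl⟩ : ∃ m, n = m + 2 := ⟨n - 2, by omega⟩
  set b := α / ((m + 2 : ℕ) : ℝ)
  have hb : 0 < b := by positivity
  -- In this form the left side is either nonpositive, hence below the positive volume, or a product
  -- of nonnegative factors increasing in `x`.
  have key (x W : ℝ) (hx : 0 < x) : -ε < 2 / (α * x ^ 2) * (W - b * x ^ (m + 2)) ↔
      x ^ 2 * (b * x ^ m - ε * α / 2) < W := by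
    have hx2 : 0 < α * x ^ 2 := by positivity
    rw [div_mul_eq_mul_div, lt_div_iff₀ hx2, pow_add]
    constructor <;> intro h <;> nlinarith
  rw [key r₁ V₀ hr₁] at h
  rw [key r V hr0]
  have hmono : b * r ^ m ≤ b * r₁ ^ m := by gcongr
  have hsq : r ^ 2 ≤ r₁ ^ 2 := by gcongr
  rcases le_total (b * r ^ m) (ε * α / 2) with hcase | hcase
  · have : r ^ 2 * (b * r ^ m - ε * α / 2) ≤ 0 :=
      mul_nonpos_of_nonneg_of_nonpos (sq_nonneg _) (by linarith)
    linarith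
  · have : r ^ 2 * (b * r ^ m - ε * α / 2) ≤ r₁ ^ 2 * (b * r₁ ^ m - ε * α / 2) :=
      mul_le_mul hsq (by linarith) (by linarith) (sq_nonneg _)
    linarith

/-- A Euclidean ball of large radius `ρ` outweighs a region of perimeter `p`. -/
theorem exists_radius_lt_massFun {n : ℕ} (hn : 3 ≤ n) {p ε : ℝ} (hp : 0 ≤ p) (hε : 0 < ε) :
    ∃ ρ δ : ℝ, 0 < ρ ∧ 0 < δ ∧ δ ≤ 1 ∧ ∀ V P : ℝ,
      (1 - δ) * (ρ ^ n * (volume (Metric.ball (0 : Euc n) 1)).toReal) ≤ V → 0 ≤ P →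
      P ≤ p + (1 + δ) ^ 2 * (sphereArea n * ρ ^ (n - 1)) → -ε < massFun n V P := by
  have hω := sphereArea_pos hn
  have hn0 : (0 : ℝ) < n := by exact_mod_cast (by omega : 0 < n)
  have hball : (volume (Metric.ball (0 : Euc n) 1)).toReal = sphereArea n / n := by
    rw [sphereArea]; field_simp
  rw [hball]
  set α := sphereArea n
  set c := p / α
  have hc : 0 ≤ c := by positivity
  -- This gives `4 c < n ε ρ`, that is, `(2 / n) (2 c / ρ) < ε`.
  set ρ := 4 * c / (n * ε) + 1
  have hρ : 0 < ρ := by positivity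
  let r : ℝ → ℝ := fun δ => ((p + (1 + δ) ^ 2 * (α * ρ ^ (n - 1))) / α) ^ (1 / ((n - 1 : ℕ) : ℝ))
  have hpos (δ : ℝ) (hδ : 0 ≤ δ) : 0 < p + (1 + δ) ^ 2 * (α * ρ ^ (n - 1)) := by positivity
  have hr0 (δ : ℝ) (hδ : 0 ≤ δ) : 0 < r δ := Real.rpow_pos_of_pos (div_pos (hpos δ hδ) hω) _
  have hrP (δ : ℝ) (hδ : 0 ≤ δ) : α * r δ ^ (n - 1) = p + (1 + δ) ^ 2 * (α * ρ ^ (n - 1)) :=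
    exists_radius_pow hn (hpos δ hδ).le
  -- The mass at the extreme allowed volume and perimeter. Its bound at `δ = 0` is strict, so
  -- continuity leaves room for some `δ > 0`.
  let f : ℝ → ℝ := fun δ => 2 / (α * r δ ^ 2) * ((1 - δ) * (ρ ^ n * (α / n)) - α / n * r δ ^ n)
  have hf0 : -ε < f 0 := by
    have h1 : r 0 ^ (n - 1) = ρ ^ (n - 1) + c := by
      have := hrP 0 le_rfl
      simp only [c]
      field_simp
      linarith
    have h2 : ρ ≤ r 0 := by
      refine le_of_pow_le_pow_left₀ (n := n - 1) (by omega) (hr0 0 le_rfl).le ?_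
      linarith
    have h3 := pow_sub_pow_le hn hρ h2 h1
    have hr := hr0 0 le_rfl
    have h4 : f 0 = -(2 / n * ((r 0 ^ n - ρ ^ n) / r 0 ^ 2)) := by
      simp only [f]
      field_simp
      ring
    have h5 : (r 0 ^ n - ρ ^ n) / r 0 ^ 2 ≤ 2 * c / ρ := by
      rw [div_le_div_iff₀ (by positivity) hρ]
      calc (r 0 ^ n - ρ ^ n) * ρ ≤ (2 * c * r 0) * r 0 := by
            apply mul_le_mul h3 h2 hρ.le (by positivity)
        _ = _ := by ring
    have h6 : 2 / n * (2 * c / ρ) < ε := by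
      rw [div_mul_div_comm, div_lt_iff₀ (by positivity)]
      have : ρ * (n * ε) = 4 * c + n * ε := by
        simp only [ρ]; field_simp
      nlinarith [mul_pos hn0 hε]
    rw [h4]
    have : 2 / n * ((r 0 ^ n - ρ ^ n) / r 0 ^ 2) ≤ 2 / n * (2 * c / ρ) :=
      mul_le_mul_of_nonneg_left h5 (by positivity)
    linarith
  have hrc : ContinuousAt r 0 := by
    refine ContinuousAt.rpow_const (by fun_prop) (Or.inl ?_)
    exact (div_pos (hpos 0 le_rfl) hω).ne'
  have hfc : ContinuousAt f 0 := by
    have : α * r 0 ^ 2 ≠ 0 := (mul_pos hω (pow_pos (hr0 0 le_rfl) 2)).ne'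
    simp only [f]
    fun_prop (disch := assumption)
  have hev : ∀ᶠ δ in 𝓝[>] (0 : ℝ), -ε < f δ :=
    (hfc.eventually (lt_mem_nhds hf0)).filter_mono nhdsWithin_le_nhds
  obtain ⟨δ, ⟨hδf, hδ1⟩, hδ0⟩ := ((hev.and (Ioo_mem_nhdsGT (zero_lt_one' ℝ))).and
    self_mem_nhdsWithin).exists
  refine ⟨ρ, δ, hρ, hδ0, hδ1.2.le, fun V P hV hP hPp => ?_⟩
  refine lt_massFun_of_le hn hε ?_ hV hP (hr0 δ hδ1.1.le) (hPp.trans_eq (hrP δ hδ1.1.le).symm) hδf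
  have := sub_pos.2 hδ1.2
  positivity

variable {n : ℕ} {H : Type*} [TopologicalSpace H] {I : ModelWithCorners ℝ (Euc n) H}
  {M : Type*} [TopologicalSpace M] [ChartedSpace H M] [IsManifold I ∞ M]
  {g : C0Metric I M} {E : AFEnd n} {F : Filling E g}
  [MeasurableSpace M] [BorelSpace M] [SecondCountableTopology M] [T2Space M]

theorem Filling.Encloses.exists_region (hn : 3 ≤ n) {ρ₀ s ε : ℝ} (h : F.Encloses ρ₀)
    (h0 : 0 < ρ₀) (hR : F.R ≤ ρ₀)
    (h1 : ∀ x, ρ₀ < ‖x‖ → IsNearEuclidean (E.coeff x) 1) (hs : ρ₀ < s) (hε : 0 < ε) :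
    ∃ (c : Euc n) (ρ : ℝ), perimeter g (F.region s c ρ) < ⊤ ∧
      -ε < quasilocalMass g (F.region s c ρ) := by
  have hω := sphereArea_pos hn
  have hs0 : 0 < s := h0.trans hs
  obtain ⟨ρ, δ, hρ, hδ0, hδ1, key⟩ := exists_radius_lt_massFun hn
    (p := 4 * (sphereArea n * s ^ (n - 1))) (ε := ε) (by positivity) hε
  obtain ⟨ρ₁, h2⟩ := E.exists_isNearEuclidean hδ0
  -- Points of the ball then have norm at least `|ρ₁| + s + 1`: beyond `ρ₁`, and clear of the sphere
  -- of radius `s`.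
  let c : Euc n := EuclideanSpace.single ⟨0, by omega⟩ (|ρ₁| + ρ + s + 1)
  have hc : ‖c‖ = |ρ₁| + ρ + s + 1 := by
    rw [PiLp.norm_single, Real.norm_of_nonneg (by positivity)]
  have hcs : ρ + s < ‖c‖ := by
    rw [hc]; linarith [abs_nonneg ρ₁]
  have h3 (x : Euc n) (hx : ‖x - c‖ ≤ ρ) : IsNearEuclidean (E.coeff x) δ := by
    refine h2 x ?_
    have := norm_le_norm_add_norm_sub x c
    linarith [le_abs_self ρ₁]
  have hper := h.perimeter_region_le hn h0 h1 hs hρ hδ0.le h3 hcs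
  refine ⟨c, ρ, hper.trans_lt ENNReal.ofReal_lt_top, ?_⟩
  refine key _ _ (F.le_riemVolume_region hρ h3 (hR.trans hs.le) hcs hδ1) ENNReal.toReal_nonneg ?_
  exact ENNReal.toReal_le_of_le_ofReal (by positivity) hper

theorem Filling.isoMass_nonneg (F : Filling E g) (hn : 3 ≤ n) : 0 ≤ isoMass g := by
  obtain ⟨r₁, hr₁⟩ := F.exists_encloses (by omega)
  obtain ⟨r₂, hr₂⟩ := E.exists_isNearEuclidean one_pos
  set ρ₀ := max F.R (max r₁ r₂) with hρ₀
  have hR : F.R ≤ ρ₀ := le_max_left _ _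
  have h0 : 0 < ρ₀ := F.R_pos.trans_le hR
  have henc : F.Encloses ρ₀ := hr₁.mono ((le_max_left _ _).trans (le_max_right _ _))
  have h1 (x : Euc n) (hx : ρ₀ < ‖x‖) : IsNearEuclidean (E.coeff x) 1 :=
    hr₂ x (((le_max_right _ _).trans (le_max_right _ _)).trans_lt hx)
  have hstep (i : ℕ) (s : Ioi ρ₀) : ∃ (c : Euc n) (ρ : ℝ), perimeter g (F.region s c ρ) < ⊤ ∧
      -(1 / ((i : ℝ) + 1)) < quasilocalMass g (F.region s c ρ) :=
    henc.exists_region hn h0 hR h1 s.2 (by positivity)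
  choose c ρ hper hmass using hstep
  -- The entry `s + 1` drives the radii to infinity; the other makes the next sphere enclose the
  -- previous distant ball, whence monotonicity.
  let next (i : ℕ) (s : Ioi ρ₀) : Ioi ρ₀ := ⟨max (s + 1) (‖c i s‖ + ρ i s),
    mem_Ioi.2 (lt_max_of_lt_left ((mem_Ioi.1 s.2).trans (lt_add_one _)))⟩
  let s : ℕ → Ioi ρ₀ := fun i => Nat.rec ⟨ρ₀ + 1, mem_Ioi.2 (lt_add_one _)⟩ next i
  let Ω : ℕ → Set M := fun i => F.region (s i).1 (c i (s i)) (ρ i (s i))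
  have hs (i : ℕ) : (s (i + 1)).1 = max ((s i).1 + 1) (‖c i (s i)‖ + ρ i (s i)) := rfl
  have hsi (i : ℕ) : (i : ℝ) < (s i).1 := by
    induction i with
    | zero => simpa using h0.trans (s 0).2
    | succ i ih =>
      rw [hs]
      push_cast
      exact lt_max_of_lt_left (by linarith)
  have hΩ : IsExhaustion g Ω := by
    refine ⟨fun i => henc.isOpen_region (s i).2 _ _, fun i => F.isCompact_closure_region _ _ _,
      fun i => hper i (s i), monotone_nat_of_le_succ fun i => ?_, ?_⟩
    · refine (F.region_subset (r := (s (i + 1)).1) ?_ ?_).trans ?_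
      · rw [hs]; exact (by linarith : (s i).1 ≤ (s i).1 + 1).trans (le_max_left _ _)
      · rw [hs]; exact le_max_right _ _
      · rintro p (hp | hp)
        · exact Or.inl hp
        · exact Or.inr (Or.inl hp.2)
    · refine eq_univ_of_forall fun p => mem_iUnion.2 ?_
      -- On the core `F.chart p` is meaningless, but membership in the region still follows from its
      -- norm, so no case split is needed.
      obtain ⟨i, hi⟩ := exists_nat_gt ‖F.chart p‖
      exact ⟨i, Or.inr (Or.inl (hi.trans (hsi i)))⟩
  refine le_iSup₂_of_le Ω hΩ ?_
  have hlim : Tendsto (fun i : ℕ => ((-(1 / ((i : ℝ) + 1)) : ℝ) : EReal)) atTop (𝓝 0) := by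
    have := (tendsto_one_div_add_atTop_nhds_zero_nat (𝕜 := ℝ)).neg
    rw [neg_zero] at this
    exact (continuous_coe_real_ereal.tendsto 0).comp this
  rw [← hlim.limsup_eq]
  exact limsup_le_limsup (Eventually.of_forall fun i =>
    EReal.coe_le_coe_iff.2 (hmass i (s i)).le)

end IsoMass

end

/-! ### Existence of a filling: a metric on `ℝⁿ` with the given end. -/

noncomputable section

namespace IsoMass

variable {n : ℕ}

/-- The bilinear form with coefficient matrix `a`. -/
def bilin (a : Matrix (Fin n) (Fin n) ℝ) : Euc n →L[ℝ] Euc n →L[ℝ] ℝ :=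
  ∑ i, ∑ j, a i j • (EuclideanSpace.proj i : Euc n →L[ℝ] ℝ).smulRight
    (EuclideanSpace.proj j : Euc n →L[ℝ] ℝ)

theorem bilin_apply (a : Matrix (Fin n) (Fin n) ℝ) (v w : Euc n) :
    bilin a v w = ∑ i, ∑ j, a i j * (v i * w j) := by
  simp [bilin, sum_apply]

theorem bilin_stdVec (a : Matrix (Fin n) (Fin n) ℝ) (i j : Fin n) :
    bilin a (stdVec i) (stdVec j) = a i j := by
  classical
  rw [bilin_apply, Finset.sum_eq_single i, Finset.sum_eq_single j]
  · simp
  · intro k _ hk; simp [hk]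
  · simp
  · intro k _ hk; simp [hk]
  · simp

theorem continuous_sum_smul {F : Type*} [NormedAddCommGroup F] [NormedSpace ℝ F]
    (L : Fin n → Fin n → F) :
    Continuous fun a : Matrix (Fin n) (Fin n) ℝ => ∑ i, ∑ j, a i j • L i j :=
  continuous_finsetSum _ fun i _ => continuous_finsetSum _ fun j _ =>
    (continuous_id.matrix_elem i j).smul continuous_const

theorem continuous_bilin : Continuous (bilin (n := n)) :=
  continuous_sum_smul fun i j => (EuclideanSpace.proj i : Euc n →L[ℝ] ℝ).smulRight
    (EuclideanSpace.proj j : Euc n →L[ℝ] ℝ)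

theorem bilin_symm {a : Matrix (Fin n) (Fin n) ℝ} (ha : a.PosDef) (v w : Euc n) :
    bilin a v w = bilin a w v := by
  rw [bilin_apply, bilin_apply, Finset.sum_comm]
  refine Finset.sum_congr rfl fun i _ => Finset.sum_congr rfl fun j _ => ?_
  have := ha.isHermitian.apply i j
  simp only [star_trivial] at this
  rw [this, mul_comm (v j)]

theorem bilin_pos {a : Matrix (Fin n) (Fin n) ℝ} (ha : a.PosDef) {v : Euc n} (hv : v ≠ 0) :
    0 < bilin a v v := by
  have h := ha.dotProduct_mulVec_pos (x := v.ofLp) (by simpa using hv)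
  rw [bilin_apply]
  refine h.trans_eq ?_
  simp only [dotProduct, Matrix.mulVec, star_trivial, Finset.mul_sum]
  refine Finset.sum_congr rfl fun i _ => Finset.sum_congr rfl fun j _ => by ring

/-- By compactness the form has a positive minimum on the unit sphere, and homogeneity spreads it to
all vectors. The sphere is empty in dimension zero. -/
theorem isBounded_bilin {a : Matrix (Fin n) (Fin n) ℝ} (ha : a.PosDef) :
    Bornology.IsBounded {v : Euc n | bilin a v v < 1} := by
  have hcont : Continuous fun v : Euc n => bilin a v v := by fun_prop
  rcases (Metric.sphere (0 : Euc n) 1).eq_empty_or_nonempty with he | hne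
  · have h0 (v : Euc n) : v = 0 := by
      by_contra hv
      have : (‖v‖⁻¹ • v) ∈ Metric.sphere (0 : Euc n) 1 := by
        rw [mem_sphere_zero_iff_norm, norm_smul, norm_inv, norm_norm,
          inv_mul_cancel₀ (norm_ne_zero_iff.2 hv)]
      rw [he] at this
      exact this
    exact (Bornology.isBounded_singleton (x := (0 : Euc n))).subset fun v _ => h0 v
  obtain ⟨u, hu, hmin⟩ := (isCompact_sphere (0 : Euc n) 1).exists_isMinOn hne hcont.continuousOn
  have hu0 : u ≠ 0 := by
    rintro rfl
    simp at hu
  have hm := bilin_pos ha hu0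
  set m := bilin a u u
  have hle (v : Euc n) : m * ‖v‖ ^ 2 ≤ bilin a v v := by
    by_cases hv : v = 0
    · simp [hv]
    have hv' : ‖v‖ ≠ 0 := norm_ne_zero_iff.2 hv
    have hs : (‖v‖⁻¹ • v) ∈ Metric.sphere (0 : Euc n) 1 := by
      rw [mem_sphere_zero_iff_norm, norm_smul, norm_inv, norm_norm, inv_mul_cancel₀ hv']
    have h1 : m ≤ bilin a (‖v‖⁻¹ • v) (‖v‖⁻¹ • v) := hmin hs
    simp only [map_smul, smul_apply, smul_eq_mul] at h1
    calc m * ‖v‖ ^ 2 ≤ (‖v‖⁻¹ * (‖v‖⁻¹ * bilin a v v)) * ‖v‖ ^ 2 := by gcongr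
      _ = bilin a v v := by field_simp
  refine (Metric.isBounded_closedBall (x := (0 : Euc n)) (r := m⁻¹ + 1)).subset fun v hv => ?_
  rw [mem_closedBall_zero_iff]
  have h2 : m * ‖v‖ ^ 2 < 1 := (hle v).trans_lt hv
  have h3 : ‖v‖ ^ 2 < m⁻¹ := by
    rwa [← one_div, lt_div_iff₀' hm]
  nlinarith [norm_nonneg v]

/-- A continuous field of bilinear forms on a normed space is a continuous section of the bundle of
bilinear forms on the tangent spaces. -/
theorem continuous_bilinSection {F : Type*} [NormedAddCommGroup F] [NormedSpace ℝ F]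
    (B : F → F →L[ℝ] F →L[ℝ] ℝ) (hc : Continuous B) :
    Continuous (fun x : F => TotalSpace.mk' (F →L[ℝ] F →L[ℝ] ℝ)
      (E := fun x : F => TangentSpace 𝓘(ℝ, F) x →L[ℝ] TangentSpace 𝓘(ℝ, F) x →L[ℝ] ℝ)
      x (B x)) := by
  refine continuous_iff_continuousAt.2 fun x => ?_
  rw [FiberBundle.continuousAt_totalSpace]
  refine ⟨continuousAt_id, ?_⟩
  refine hc.continuousAt.congr (Eventually.of_forall fun y => ?_)
  -- Over a vector space the tangent trivializations are the identity, so the section read in the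
  -- trivialization is `B` itself.
  have h1 (v : F) : (trivializationAt F (TangentSpace 𝓘(ℝ, F)) x).symmL ℝ y v = v :=
    DFunLike.congr_fun (TangentBundle.symmL_model_space (𝕜 := ℝ) x y) v
  refine ContinuousLinearMap.ext fun v => ContinuousLinearMap.ext fun w => ?_
  let e₀ := trivializationAt ℝ (Bundle.Trivial F ℝ) x
  let e := trivializationAt F (TangentSpace 𝓘(ℝ, F)) x
  let e₂ := trivializationAt (F →L[ℝ] ℝ)
    (fun x : F => TangentSpace 𝓘(ℝ, F) x →L[ℝ] Bundle.Trivial F ℝ x) x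
  have h2 (φ : F →L[ℝ] ℝ) (w : F) : e₂.continuousLinearMapAt ℝ y φ w = φ w := by
    have hy : y ∈ e₂.baseSet := by simp [e₂, chartAt_self_eq]
    have h3 : e₂.continuousLinearMapAt ℝ y φ = (e₂ ⟨y, φ⟩).2 :=
      congrFun (e₂.coe_linearMapAt_of_mem (R := ℝ) hy) φ
    have h4 : (e₂ ⟨y, φ⟩).2 w = e₀.continuousLinearMapAt ℝ y (φ (e.symmL ℝ y w)) := rfl
    rw [h3, h4, h1]
    simp [e₀]
  change B y v w = e₂.continuousLinearMapAt ℝ y (B y (e.symmL ℝ y v)) w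
  rw [h1, h2]

/-- The continuous Riemannian metric on a normed space that is given by a continuous field of
bilinear forms. -/
def metricOfBilin {F : Type*} [NormedAddCommGroup F] [NormedSpace ℝ F]
    (B : F → F →L[ℝ] F →L[ℝ] ℝ) (hc : Continuous B) (hs : ∀ x v w, B x v w = B x w v)
    (hp : ∀ x v, v ≠ 0 → 0 < B x v v) (hb : ∀ x, Bornology.IsBounded {v | B x v v < 1}) :
    ContinuousRiemannianMetric F (fun x : F => TangentSpace 𝓘(ℝ, F) x) where
  inner x := (B x : F →L[ℝ] F →L[ℝ] ℝ)
  symm x v w := hs x v w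
  pos x v hv := hp x v hv
  isVonNBounded x := by
    change Bornology.IsVonNBounded ℝ {v : F | B x v v < 1}
    exact NormedSpace.isVonNBounded_of_isBounded ℝ (hb x)
  continuous := continuous_bilinSection B hc

/-- The continuous Riemannian metric on `ℝⁿ` with the given coefficients. -/
def metricOfCoeff (a : Euc n → Matrix (Fin n) (Fin n) ℝ) (hc : Continuous a)
    (ha : ∀ x, (a x).PosDef) : C0Metric (𝓡 n) (Euc n) :=
  (metricOfBilin (fun x => bilin (a x)) (continuous_bilin.comp hc) (fun x => bilin_symm (ha x))
    (fun x _ hv => bilin_pos (ha x) hv)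
    (fun x => isBounded_bilin (ha x)))

/-- The coefficients of the end, deformed to the Euclidean ones in the interior. -/
def AFEnd.fill (E : AFEnd n) (x : Euc n) : Matrix (Fin n) (Fin n) ℝ :=
  (1 - ramp 0 (E.r₀ + 1) (E.r₀ + 2) x) • E.coeff x + ramp 0 (E.r₀ + 1) (E.r₀ + 2) x • 1

variable (E : AFEnd n)

theorem AFEnd.fill_of_norm_le {x : Euc n} (hx : ‖x‖ ≤ E.r₀ + 1) : E.fill x = 1 := by
  have := E.r₀_pos
  rw [AFEnd.fill, ramp_eq_one 0 (by linarith) (by linarith) (by simpa using hx)]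
  simp

theorem AFEnd.fill_of_lt_norm {x : Euc n} (hx : E.r₀ + 2 < ‖x‖) : E.fill x = E.coeff x := by
  have := E.r₀_pos
  rw [AFEnd.fill, ramp_eq_zero 0 (by linarith) (by linarith) (by simpa using hx.le)]
  simp

/-- The uncontrolled values of `coeff` inside radius `r₀` carry the factor 0; from radius `r₀ + 1`
on, `coeff` is continuous. -/
theorem AFEnd.continuous_fill : Continuous E.fill := by
  refine continuous_iff_continuousAt.2 fun x => ?_
  rcases lt_or_ge ‖x‖ (E.r₀ + 1) with hx | hx
  · refine (continuousAt_const (y := (1 : Matrix (Fin n) (Fin n) ℝ))).congr ?_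
    filter_upwards [continuous_norm.continuousAt.eventually_lt continuousAt_const hx] with y hy
    exact (E.fill_of_norm_le hy.le).symm
  · have h1 : ContinuousAt E.coeff x := E.continuousOn_coeff.continuousAt
      ((isOpen_lt continuous_const continuous_norm).mem_nhds (by
        change E.r₀ < ‖x‖
        linarith))
    have h2 := (contDiff_ramp (0 : Euc n) (E.r₀ + 1) (E.r₀ + 2)).continuous.continuousAt (x := x)
    exact ((continuousAt_const.sub h2).smul h1).add (h2.smul continuousAt_const)

theorem AFEnd.posDef_fill (x : Euc n) : (E.fill x).PosDef := by
  rcases le_or_gt ‖x‖ (E.r₀ + 1) with hx | hx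
  · rw [E.fill_of_norm_le hx]
    exact Matrix.PosDef.one
  · have h1 := E.posDef_coeff x (by linarith)
    have h2 := ramp_nonneg 0 (E.r₀ + 1) (E.r₀ + 2) x
    have h3 := ramp_le_one 0 (E.r₀ + 1) (E.r₀ + 2) x
    rw [AFEnd.fill]
    rcases h2.eq_or_lt with h | h
    · rw [← h]; simpa using h1
    -- The identity term supplies definiteness, since the weight of `coeff` may vanish here.
    · exact Matrix.PosDef.posSemidef_add (h1.posSemidef.smul (sub_nonneg.2 h3))
        (Matrix.PosDef.one.smul h)

theorem AFEnd.exists_filling : ∃ g : C0Metric (𝓡 n) (Euc n), Nonempty (Filling E g) := by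
  have hopen : IsOpen {x : Euc n | E.r₀ + 2 < ‖x‖} := isOpen_lt continuous_const continuous_norm
  refine ⟨metricOfCoeff E.fill E.continuous_fill E.posDef_fill, ⟨{
    R := E.r₀ + 2
    r₀_le := by linarith
    core := Metric.closedBall 0 (E.r₀ + 2)
    isCompact_core := isCompact_closedBall _ _
    chart := OpenPartialHomeomorph.ofSet _ hopen
    source_eq := by ext x; simp
    target_eq := rfl
    contMDiffOn_chart := contMDiff_id.contMDiffOn
    contMDiffOn_symm := contMDiff_id.contMDiffOn
    metric_eq := fun x hx i j => ?_
    isCompact_enclosed := fun ρ => ?_ }⟩⟩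
  · have h : mfderiv 𝓘(ℝ, Euc n) (𝓡 n) (OpenPartialHomeomorph.ofSet _ hopen).symm x =
        ContinuousLinearMap.id ℝ (TangentSpace 𝓘(ℝ, Euc n) x) := mfderiv_id
    rw [h, ← E.fill_of_lt_norm hx]
    exact bilin_stdVec _ _ _
  · have : Metric.closedBall (0 : Euc n) (E.r₀ + 2) ∪ {p | p ∉ Metric.closedBall 0 (E.r₀ + 2) ∧
        ‖p‖ ≤ ρ} = Metric.closedBall 0 (max (E.r₀ + 2) ρ) := by
      ext x
      simp only [mem_union, mem_closedBall_zero_iff, mem_ofPred_eq, le_max_iff]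
      tauto
    change IsCompact (Metric.closedBall (0 : Euc n) (E.r₀ + 2) ∪
      {p | p ∉ Metric.closedBall 0 (E.r₀ + 2) ∧ ‖p‖ ≤ ρ})
    rw [this]
    exact isCompact_closedBall _ _

end IsoMass

end
theorem mainTheorem1 {n : ℕ} (hn : 3 ≤ n) (E : IsoMass.AFEnd n) :
    (∃ g : IsoMass.C0Metric (𝓡 n) (IsoMass.Euc n), Nonempty (IsoMass.Filling E g)) ∧
    ∀ {H : Type*} [TopologicalSpace H] (I : ModelWithCorners ℝ (IsoMass.Euc n) H)
      {M : Type*} [TopologicalSpace M] [T2Space M] [SecondCountableTopology M]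
      [ChartedSpace H M] [IsManifold I ∞ M] [MeasurableSpace M] [BorelSpace M]
      (g : IsoMass.C0Metric I M),
      Nonempty (IsoMass.Filling E g) → 0 ≤ IsoMass.isoMass g := by
  refine ⟨E.exists_filling, ?_⟩
  intro H _ I M _ _ _ _ _ _ _ g ⟨F⟩
  exact F.isoMass_nonneg hn
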